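/- Let $\mathcal J$ be the set of inclusions $S^{d-1}\to D^{d}$, $d\ge 0$ (with $S^{-1}=\emptyset$), regarded as a discrete category over the arrow category $\mathbf{Top}^{\mathbf 2}$. *Relative cell complexes.* A *stratum* on a space $X$ is a set $S$ of cells, each $s\in S$ with a shape $\kappa_s=(S^{d_s-1}\to D^{d_s})\in\mathcal J$ and a continuous attaching map $b_s\colon S^{d_s-1}\to X$; its *body* is the pushout of $X\leftarrow\coprod_s S^{d_s-1}\to\coprod_s D^{d_s}$. A *relative cell complex* on a map $f\colon X\to Y$ is a sequence of strata $(X_n,S_n)_{n\in\mathbb N}$ with $X_0= X$, with $X_{n+1}$ the body of $(X_n,S_n)$, with $X_0\to\operatorname{colim}X_n= Y$ equal to $f$, and *proper*: for $s\in S_n$ the map $b_s$ does not factor through $X_m$ for any $m<n$. (Pushouts, colimits and $X_0$ are taken up to specified isomorphism.) A morphism is a sequence of maps $f_n\colon X_n\to X'_n$ and shape-preserving functions $p_n\colon S_n\to S'_n$ with $f_n b_s=b_{p_n(s)}$ and with $f_{n+1}$ induced by $(f_n,p_n)$. This defines a category $\mathbf{CellCx}$ with forgetful functor $U\colon\mathbf{CellCx}\to\mathbf{Top}^{\mathbf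 2}$, and $\eta\colon\mathcal J\to\mathbf{CellCx}$ sends a map of $\mathcal J$ to its height-one complex with a single cell. If $A$ is a relative cell complex on $f\colon X\to Y$ and $B$ one on $g\colon Y\to Z$, a *composite* $B*A$ is a relative cell complex on $gf$ whose cells are those of $A$ and those of $B$ (disjoint union), with the same shapes and the same characteristic maps to $Z$; properness then forces each cell into the lowest possible stratum. *Left maps.* An algebraic weak factorisation system (awfs) $(L,R)$ on $\mathbf{Top}$ is a functorial factorisation $f=Rf\circ Lf$ through a functor $M\colon\mathbf{Top}^{\mathbf 2}\to\mathbf{Top}$, with a comonad structure on the copointed endofunctor $L$ (comultiplication $(1,\delta_f)$) and a monad structure on the pointed endofunctor $R$ (multiplication $(\mu_f,1)$), such that $(\delta_f,\mu_f)\colon LRf\to RLf$ is a distributive law of the comonad over the monad. $L\text{-}\mathbf{Map}$ is the category of $L$-coalgebras, over $\mathbf{Top}^{\mathbf 2}$. The composite of left maps $(f,\alpha)$ and $(g,\beta)$, $f\colon X\to Y$, $g\colon Y\to Z$, is $(gf,\beta\bullet\alpha)$ with $\beta\bullet\alpha=\mu_{gf}\circ M\big(M(1,g)\circ\alpha,\,1\big)\circ\beta$.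 **Proposition.** Any two composable relative cell complexes have a composite. For any awfs $(L,R)$ on $\mathbf{Top}$ and any functor $F\colon\mathcal J\to L\text{-}\mathbf{Map}$ over $\mathbf{Top}^{\mathbf 2}$, there is a unique functor $F'\colon\mathbf{CellCx}\to L\text{-}\mathbf{Map}$ over $\mathbf{Top}^{\mathbf 2}$ such that $F=F'\circ\eta$ and $F'$ preserves composition, i.e. $F'$ sends every composite $B*A$ to the composite left map $F'B\bullet F'A$. -/

import Mathlib

open CategoryTheory CategoryTheory.Limits

universe v w u

/-! ### Algebraic weak factorisation systems -/

/-- A functorial factorisation on `C`: a central functor `M : C² ⥤ C` together with natural maps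
`lam f : dom f ⟶ M f` and `rho f : M f ⟶ cod f` whose composite is `f`. -/
structure FunctFact (C : Type w) [Category.{v} C] where
  M : Arrow C ⥤ C
  lam (f : Arrow C) : f.left ⟶ M.obj f
  rho (f : Arrow C) : M.obj f ⟶ f.right
  lam_naturality {f g : Arrow C} (φ : f ⟶ g) : φ.left ≫ lam g = lam f ≫ M.map φ
  rho_naturality {f g : Arrow C} (φ : f ⟶ g) : M.map φ ≫ rho g = rho f ≫ φ.right
  fac (f : Arrow C) : lam f ≫ rho f = f.hom

namespace FunctFact

variable {C : Type w} [Category.{v} C] (W : FunctFact C)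

/-- The domain-preserving endofunctor `L` of `C²`, with `L f = lam f`. -/
abbrev L : Arrow C ⥤ Arrow C where
  obj f := Arrow.mk (W.lam f)
  map φ := Arrow.homMk φ.left (W.M.map φ) (W.lam_naturality φ)

/-- The codomain-preserving endofunctor `R` of `C²`, with `R f = rho f`. -/
abbrev R : Arrow C ⥤ Arrow C where
  obj f := Arrow.mk (W.rho f)
  map φ := Arrow.homMk (W.M.map φ) φ.right (W.rho_naturality φ)

/-- The copoint `(1, R f) : L f ⟶ f`. -/
abbrev ε : W.L ⟶ 𝟭 (Arrow C) where
  app f := Arrow.homMk (𝟙 f.left) (W.rho f) ((Category.id_comp _).trans (W.fac f).symm)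
  naturality _ _ φ := Arrow.hom_ext _ _
    ((Category.comp_id _).trans (Category.id_comp _).symm) (W.rho_naturality φ)

/-- The point `(L f, 1) : f ⟶ R f`. -/
abbrev η : 𝟭 (Arrow C) ⟶ W.R where
  app f := Arrow.homMk (W.lam f) (𝟙 f.right) ((W.fac f).trans (Category.comp_id _).symm)
  naturality _ _ φ := Arrow.hom_ext _ _
    (W.lam_naturality φ) ((Category.comp_id _).trans (Category.id_comp _).symm)

end FunctFact

/-- A functorial factorisation whose copointed endofunctor `L` is made into a comonad and whose
pointed endofunctor `R` is made into a monad. -/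
structure PreAWFS (C : Type w) [Category.{v} C] extends FunctFact C where
  δ : toFunctFact.L ⟶ toFunctFact.L ⋙ toFunctFact.L
  coassoc (f : Arrow C) :
    δ.app f ≫ toFunctFact.L.map (δ.app f) = δ.app f ≫ δ.app (toFunctFact.L.obj f)
  left_counit (f : Arrow C) : δ.app f ≫ toFunctFact.ε.app (toFunctFact.L.obj f) = 𝟙 _
  right_counit (f : Arrow C) : δ.app f ≫ toFunctFact.L.map (toFunctFact.ε.app f) = 𝟙 _
  μ : toFunctFact.R ⋙ toFunctFact.R ⟶ toFunctFact.R
  assoc (f : Arrow C) :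
    toFunctFact.R.map (μ.app f) ≫ μ.app f = μ.app (toFunctFact.R.obj f) ≫ μ.app f
  left_unit (f : Arrow C) : toFunctFact.η.app (toFunctFact.R.obj f) ≫ μ.app f = 𝟙 _
  right_unit (f : Arrow C) : toFunctFact.R.map (toFunctFact.η.app f) ≫ μ.app f = 𝟙 _

namespace PreAWFS

variable {C : Type w} [Category.{v} C] (W : PreAWFS C)

/-- The comonad `(L, ε, δ)` on `C²`. -/
def comonad : Comonad (Arrow C) where
  toFunctor := W.L
  ε := W.ε
  δ := W.δ
  coassoc := W.coassoc
  left_counit := W.left_counit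
  right_counit := W.right_counit

/-- The monad `(R, η, μ)` on `C²`. -/
def monad : Monad (Arrow C) where
  toFunctor := W.R
  η := W.η
  μ := W.μ
  assoc := W.assoc
  left_unit := W.left_unit
  right_unit := W.right_unit

/-- The nontrivial component `M f ⟶ M (L f)` of the comultiplication. -/
def comul (f : Arrow C) : W.M.obj f ⟶ W.M.obj (W.L.obj f) := (W.δ.app f).right

/-- The nontrivial component `M (R f) ⟶ M f` of the multiplication. -/
def mul (f : Arrow C) : W.M.obj (W.R.obj f) ⟶ W.M.obj f := (W.μ.app f).left

/-- The component `(δ_f, μ_f) : L (R f) ⟶ R (L f)` of the transformation `Δ : LR ⟶ RL`. -/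
def Δ (f : Arrow C) : W.L.obj (W.R.obj f) ⟶ W.R.obj (W.L.obj f) :=
  Arrow.homMk (W.comul f) (W.mul f) (by
    have h₁ := congrArg CommaMorphism.right (W.left_counit f)
    have h₂ := congrArg CommaMorphism.left (W.left_unit f)
    simp at h₁ h₂
    exact h₁.trans h₂.symm)

end PreAWFS

/-- An algebraic weak factorisation system on `C`: the transformation `Δ : LR ⟶ RL` is moreover a
distributive law of the comonad `L` over the monad `R`. -/
structure AWFS (C : Type w) [Category.{v} C] extends PreAWFS C where
  distrib_unit (f : Arrow C) : toFunctFact.L.map (toFunctFact.η.app f) ≫ toPreAWFS.Δ f = toFunctFact.η.app (toFunctFact.L.obj f)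
  distrib_counit (f : Arrow C) : toPreAWFS.Δ f ≫ toFunctFact.R.map (toFunctFact.ε.app f) = toFunctFact.ε.app (toFunctFact.R.obj f)
  distrib_mul (f : Arrow C) :
    toFunctFact.L.map (μ.app f) ≫ toPreAWFS.Δ f =
      toPreAWFS.Δ (toFunctFact.R.obj f) ≫ toFunctFact.R.map (toPreAWFS.Δ f) ≫ μ.app (toFunctFact.L.obj f)
  distrib_comul (f : Arrow C) :
    toPreAWFS.Δ f ≫ toFunctFact.R.map (δ.app f) =
      δ.app (toFunctFact.R.obj f) ≫ toFunctFact.L.map (toPreAWFS.Δ f) ≫ toPreAWFS.Δ (toFunctFact.L.obj f)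

namespace AWFS

variable {C : Type w} [Category.{v} C] (W : AWFS C)

/-- The category of left maps: coalgebras for the comonad `L`. -/
abbrev LMap := W.comonad.Coalgebra

/-- The forgetful functor from left maps to arrows. -/
abbrev forget : W.LMap ⥤ Arrow C := W.comonad.forget

/-- A left map structure on `f`: an `L`-coalgebra structure on the arrow `f`. -/
structure LeftStr {X Y : C} (f : X ⟶ Y) where
  a : Arrow.mk f ⟶ W.L.obj (Arrow.mk f)
  counit : a ≫ W.ε.app (Arrow.mk f) = 𝟙 _
  coassoc : a ≫ W.δ.app (Arrow.mk f) = a ≫ W.L.map a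

namespace LeftStr

variable {W} {X Y Z : C} {f : X ⟶ Y} {g : Y ⟶ Z}

/-- A map with a left map structure, as a left map. -/
def toLMap (α : W.LeftStr f) : W.LMap where
  A := Arrow.mk f
  a := α.a
  counit := α.counit
  coassoc := α.coassoc

/-- The structure map `Y ⟶ M f`; the domain component of a coalgebra structure is the identity. -/
def str (α : W.LeftStr f) : Y ⟶ W.M.obj (Arrow.mk f) := α.a.right

lemma a_left (α : W.LeftStr f) : α.a.left = 𝟙 X :=
  (Category.comp_id _).symm.trans (congrArg CommaMorphism.left α.counit)

lemma str_rho (α : W.LeftStr f) : α.str ≫ W.rho (Arrow.mk f) = 𝟙 Y :=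
  congrArg CommaMorphism.right α.counit

lemma comp_str (α : W.LeftStr f) : f ≫ α.str = W.lam (Arrow.mk f) := by
  have h : α.a.left ≫ W.lam (Arrow.mk f) = f ≫ α.str := Arrow.w α.a
  rw [α.a_left] at h
  exact h.symm.trans (Category.id_comp _)

lemma str_comul (α : W.LeftStr f) :
    α.str ≫ W.comul (Arrow.mk f) = α.str ≫ W.M.map α.a :=
  congrArg CommaMorphism.right α.coassoc

/-- The square `(1, g) : f ⟶ f ≫ g`. -/
def postcomp (f : X ⟶ Y) (g : Y ⟶ Z) : Arrow.mk f ⟶ Arrow.mk (f ≫ g) :=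
  Arrow.homMk (𝟙 X) g (Category.id_comp _)

/-- The square `(M(1, g) ∘ α, 1) : g ⟶ R (f ≫ g)`. -/
def push (α : W.LeftStr f) (g : Y ⟶ Z) : Arrow.mk g ⟶ W.R.obj (Arrow.mk (f ≫ g)) :=
  Arrow.homMk (α.str ≫ W.M.map (postcomp f g)) (𝟙 Z) (by
    have h : W.M.map (postcomp f g) ≫ W.rho (Arrow.mk (f ≫ g)) =
      W.rho (Arrow.mk f) ≫ g := W.rho_naturality (postcomp f g)
    change (α.str ≫ W.M.map (postcomp f g)) ≫ W.rho (Arrow.mk (f ≫ g)) = g ≫ 𝟙 Z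
    rw [Category.assoc, h, reassoc_of% α.str_rho, Category.comp_id])

/-- The structure map `μ ∘ M(M(1, g) ∘ α, 1) ∘ β : Z ⟶ M (f ≫ g)` of the composite. -/
def compStr (α : W.LeftStr f) (β : W.LeftStr g) : Z ⟶ W.M.obj (Arrow.mk (f ≫ g)) :=
  β.str ≫ W.M.map (α.push g) ≫ W.mul (Arrow.mk (f ≫ g))

lemma _root_.PreAWFS.mul_rho (V : PreAWFS C) (h : Arrow C) :
    V.mul h ≫ V.rho h = V.rho (V.R.obj h) := by
  have h₁ : (V.μ.app h).right = 𝟙 h.right :=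
    (Category.id_comp _).symm.trans (congrArg CommaMorphism.right (V.left_unit h))
  have h₂ : V.mul h ≫ V.rho h = V.rho (V.R.obj h) ≫ (V.μ.app h).right :=
    Arrow.w (V.μ.app h)
  rw [h₂, h₁]
  exact Category.comp_id _

lemma _root_.PreAWFS.lam_mul (V : PreAWFS C) (h : Arrow C) :
    V.lam (V.R.obj h) ≫ V.mul h = 𝟙 (V.M.obj h) :=
  congrArg CommaMorphism.left (V.left_unit h)

lemma compStr_rho (α : W.LeftStr f) (β : W.LeftStr g) :
    α.compStr β ≫ W.rho (Arrow.mk (f ≫ g)) = 𝟙 Z := by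
  have h : W.M.map (α.push g) ≫ W.rho (W.R.obj (Arrow.mk (f ≫ g))) =
      W.rho (Arrow.mk g) := (W.rho_naturality (α.push g)).trans (Category.comp_id _)
  rw [compStr, Category.assoc, Category.assoc, PreAWFS.mul_rho, h, str_rho]

lemma comp_compStr' (α : W.LeftStr f) (β : W.LeftStr g) :
    g ≫ α.compStr β = α.str ≫ W.M.map (postcomp f g) := by
  have h : W.lam (Arrow.mk g) ≫ W.M.map (α.push g) =
      (α.str ≫ W.M.map (postcomp f g)) ≫ W.lam (W.R.obj (Arrow.mk (f ≫ g))) :=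
    (W.lam_naturality (α.push g)).symm
  rw [compStr, reassoc_of% β.comp_str, ← Category.assoc, h, Category.assoc, PreAWFS.lam_mul]
  exact Category.comp_id _

lemma comp_compStr (α : W.LeftStr f) (β : W.LeftStr g) :
    (f ≫ g) ≫ α.compStr β = W.lam (Arrow.mk (f ≫ g)) := by
  rw [Category.assoc, comp_compStr', reassoc_of% α.comp_str]
  exact (W.lam_naturality (postcomp f g)).symm.trans (Category.id_comp _)

/-- The coalgebra square of the composite. -/
def compA (α : W.LeftStr f) (β : W.LeftStr g) :
    Arrow.mk (f ≫ g) ⟶ W.L.obj (Arrow.mk (f ≫ g)) :=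
  Arrow.homMk (𝟙 X) (α.compStr β) ((Category.id_comp _).trans (α.comp_compStr β).symm)

lemma distrib (h : Arrow C) :
    W.mul h ≫ W.comul h =
      W.comul (W.R.obj h) ≫ W.M.map (W.Δ h) ≫ W.mul (W.L.obj h) :=
  congrArg CommaMorphism.right (W.distrib_comul h)

lemma comul_naturality {h k : Arrow C} (φ : h ⟶ k) :
    W.M.map φ ≫ W.comul k = W.comul h ≫ W.M.map (W.L.map φ) :=
  congrArg CommaMorphism.right (W.δ.naturality φ)

lemma mul_naturality {h k : Arrow C} (φ : h ⟶ k) :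
    W.M.map (W.R.map φ) ≫ W.mul k = W.mul h ≫ W.M.map φ :=
  congrArg CommaMorphism.left (W.μ.naturality φ)

lemma compStr_comul (α : W.LeftStr f) (β : W.LeftStr g) :
    α.compStr β ≫ W.comul (Arrow.mk (f ≫ g)) = α.compStr β ≫ W.M.map (α.compA β) := by
  have key : β.a ≫ W.L.map (α.push g) ≫ W.Δ (Arrow.mk (f ≫ g)) =
      α.push g ≫ W.R.map (α.compA β) := by
    refine Arrow.hom_ext _ _ ?_ ?_
    · change β.a.left ≫ (α.str ≫ W.M.map (postcomp f g)) ≫ W.comul (Arrow.mk (f ≫ g)) =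
        (α.str ≫ W.M.map (postcomp f g)) ≫ W.M.map (α.compA β)
      have hs : α.a ≫ W.L.map (postcomp f g) = postcomp f g ≫ α.compA β := by
        refine Arrow.hom_ext _ _ ?_ ?_
        · change α.a.left ≫ 𝟙 X = 𝟙 X ≫ 𝟙 X
          rw [α.a_left]
        · exact (α.comp_compStr' β).symm
      rw [β.a_left, Category.assoc, comul_naturality, reassoc_of% α.str_comul, ← W.M.map_comp, hs,
        W.M.map_comp, Category.assoc]
      exact Category.id_comp _
    · change β.str ≫ W.M.map (α.push g) ≫ W.mul (Arrow.mk (f ≫ g)) = 𝟙 Z ≫ α.compStr β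
      rw [Category.id_comp, compStr]
  rw [compStr, Category.assoc, Category.assoc, Category.assoc, Category.assoc, distrib,
    ← mul_naturality, ← Category.assoc (W.M.map (α.push g)), comul_naturality,
    Category.assoc, reassoc_of% β.str_comul]
  simp only [← Category.assoc]
  congr 1
  simp only [Category.assoc, ← W.M.map_comp]
  rw [key]

/-- The composite left map structure `β • α` on `f ≫ g`. -/
def comp (α : W.LeftStr f) (β : W.LeftStr g) : W.LeftStr (f ≫ g) where
  a := α.compA β
  counit := Arrow.hom_ext _ _ (Category.comp_id _) (α.compStr_rho β)
  coassoc := by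
    refine Arrow.hom_ext _ _ ?_ (α.compStr_comul β)
    have h : (W.δ.app (Arrow.mk (f ≫ g))).left = 𝟙 X :=
      (Category.comp_id _).symm.trans
        (congrArg CommaMorphism.left (W.left_counit (Arrow.mk (f ≫ g))))
    change 𝟙 X ≫ (W.δ.app (Arrow.mk (f ≫ g))).left = 𝟙 X ≫ 𝟙 X
    rw [h]

end LeftStr

/-- `IsComposite a b c`: the left maps `a` and `b` are composable and `c` is the composite left map
`b • a`. -/
inductive IsComposite : W.LMap → W.LMap → W.LMap → Prop
  | mk {X Y Z : C} {f : X ⟶ Y} {g : Y ⟶ Z} (α : W.LeftStr f) (β : W.LeftStr g) :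
      IsComposite α.toLMap β.toLMap (α.comp β).toLMap

end AWFS

/-! ### Strata and relative cell complexes -/

open TopCat in
/-- The set `J` of inclusions `S^{n-1} ⟶ D^n`, `n ≥ 0`, as a discrete category over arrows. -/
noncomputable def genCells : Discrete ℕ ⥤ Arrow TopCat.{u} :=
  Discrete.functor fun d => Arrow.mk (diskBoundaryInclusion.{u} d)

open TopCat in
/-- A stratum with boundary `X`, whose body is presented by the map `i : X ⟶ X'`. The set of cells
is graded by the shape of the cells: `cells d` is the set of cells `s` with `κ_s = (S^{d-1} ⟶ D^d)`.
The map `char s` is the structure map of the pushout on the summand `s`. -/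
structure Stratum {X X' : TopCat.{u}} (i : X ⟶ X') where
  cells : ℕ → Type u
  attach {d : ℕ} (s : cells d) : ∂𝔻 d ⟶ X
  char {d : ℕ} (s : cells d) : 𝔻 d ⟶ X'
  isPushout : IsPushout
    (Limits.Sigma.map fun s : Σ d, cells d => diskBoundaryInclusion.{u} s.1)
    (Limits.Sigma.desc fun s : Σ d, cells d => attach s.2)
    (Limits.Sigma.desc fun s : Σ d, cells d => char s.2) i

open TopCat in
/-- A relative cell complex structure on `f : X ⟶ Y`: a proper connected sequence of strata, with
boundary `X`, whose transfinite composite is `f`. Bodies of strata and transfinite composites are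
only determined up to isomorphism, so any pushout and any colimit is allowed. -/
structure CellStr {X Y : TopCat.{u}} (f : X ⟶ Y) where
  stage : ℕ ⥤ TopCat.{u}
  base : X ≅ stage.obj 0
  stratum (n : ℕ) : Stratum (stage.map (homOfLE n.le_succ))
  proper (n d : ℕ) (s : (stratum n).cells d) (m : ℕ) (h : m < n) :
    ¬ ∃ b : ∂𝔻 d ⟶ stage.obj m, b ≫ stage.map (homOfLE h.le) = (stratum n).attach s
  toBody (n : ℕ) : stage.obj n ⟶ Y
  toBody_naturality {m n : ℕ} (h : m ≤ n) : stage.map (homOfLE h) ≫ toBody n = toBody m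
  isColimit : IsColimit (Cocone.mk Y
    { app := toBody
      naturality := fun _ _ φ =>
        (toBody_naturality (leOfHom φ)).trans (Category.comp_id _).symm } : Cocone stage)
  base_toBody : base.hom ≫ toBody 0 = f

namespace CellStr

open TopCat

variable {X Y Z : TopCat.{u}} {f : X ⟶ Y} {g : Y ⟶ Z}

/-- The set of all cells of shape `S^{d-1} ⟶ D^d` of a relative cell complex. -/
abbrev Cell (σ : CellStr f) (d : ℕ) : Type u := Σ n, (σ.stratum n).cells d

/-- The characteristic map of a cell, with values in the body of the complex. -/
noncomputable def charMap (σ : CellStr f) {d : ℕ} (s : σ.Cell d) : 𝔻 d ⟶ Y :=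
  (σ.stratum s.1).char s.2 ≫ σ.toBody (s.1 + 1)

/-- `ρ` is a composite of `σ` followed by `τ`: the cells of `ρ` are the cells of `σ` together with
the cells of `τ`, glued into the body in the same way. By properness each cell lies in the lowest
possible stratum of `ρ`, so there is no choice for the strata of `ρ`. -/
def IsComposite (σ : CellStr f) (τ : CellStr g) (ρ : CellStr (f ≫ g)) : Prop :=
  ∃ e : ∀ d, σ.Cell d ⊕ τ.Cell d ≃ ρ.Cell d,
    (∀ d (s : σ.Cell d), ρ.charMap (e d (Sum.inl s)) = σ.charMap s ≫ g) ∧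
    (∀ d (t : τ.Cell d), ρ.charMap (e d (Sum.inr t)) = τ.charMap t)

end CellStr

/-- Relative cell complexes. -/
structure CellCx : Type (u + 1) where
  boundary : TopCat.{u}
  body : TopCat.{u}
  map : boundary ⟶ body
  str : CellStr map

namespace CellCx

/-- A morphism of relative cell complexes: a sequence of morphisms of strata `(f_n, p_n)` such that
`f_{n+1}` is the map of bodies induced by `(f_n, p_n)`. The maps of boundaries and of bodies are
those induced by the sequence. -/
@[ext]
structure Hom (A B : CellCx.{u}) where
  left : A.boundary ⟶ B.boundary
  right : A.body ⟶ B.body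
  stageMap (n : ℕ) : A.str.stage.obj n ⟶ B.str.stage.obj n
  cellMap (n d : ℕ) : (A.str.stratum n).cells d → (B.str.stratum n).cells d
  attach_stageMap (n d : ℕ) (s : (A.str.stratum n).cells d) :
    (A.str.stratum n).attach s ≫ stageMap n = (B.str.stratum n).attach (cellMap n d s)
  char_stageMap (n d : ℕ) (s : (A.str.stratum n).cells d) :
    (A.str.stratum n).char s ≫ stageMap (n + 1) = (B.str.stratum n).char (cellMap n d s)
  stageMap_succ (n : ℕ) :
    A.str.stage.map (homOfLE n.le_succ) ≫ stageMap (n + 1) =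
      stageMap n ≫ B.str.stage.map (homOfLE n.le_succ)
  base_stageMap : A.str.base.hom ≫ stageMap 0 = left ≫ B.str.base.hom
  toBody_right (n : ℕ) : A.str.toBody n ≫ right = stageMap n ≫ B.str.toBody n

instance : Category CellCx.{u} where
  Hom := Hom
  id A :=
    { left := 𝟙 _
      right := 𝟙 _
      stageMap := fun _ => 𝟙 _
      cellMap := fun _ _ s => s
      attach_stageMap := by simp
      char_stageMap := by simp
      stageMap_succ := by simp
      base_stageMap := by simp
      toBody_right := by simp }
  comp φ ψ :=
    { left := φ.left ≫ ψ.left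
      right := φ.right ≫ ψ.right
      stageMap := fun n => φ.stageMap n ≫ ψ.stageMap n
      cellMap := fun n d s => ψ.cellMap n d (φ.cellMap n d s)
      attach_stageMap := fun n d s => by
        rw [reassoc_of% φ.attach_stageMap, ψ.attach_stageMap]
      char_stageMap := fun n d s => by
        rw [reassoc_of% φ.char_stageMap, ψ.char_stageMap]
      stageMap_succ := fun n => by
        rw [reassoc_of% φ.stageMap_succ, ψ.stageMap_succ, Category.assoc]
      base_stageMap := by
        rw [reassoc_of% φ.base_stageMap, ψ.base_stageMap, Category.assoc]
      toBody_right := fun n => by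
        rw [reassoc_of% φ.toBody_right, ψ.toBody_right, Category.assoc] }
  id_comp _ := by ext <;> simp
  comp_id _ := by ext <;> simp
  assoc _ _ _ := by ext <;> simp

/-- The forgetful functor from relative cell complexes to arrows of spaces. -/
def U : CellCx.{u} ⥤ Arrow TopCat.{u} where
  obj A := Arrow.mk A.map
  map {A B} φ := Arrow.homMk φ.left φ.right (by
    have h : A.str.base.hom ≫ A.str.toBody 0 ≫ φ.right =
        φ.left ≫ B.str.base.hom ≫ B.str.toBody 0 := by
      rw [φ.toBody_right, reassoc_of% φ.base_stageMap]
    rw [B.str.base_toBody, ← Category.assoc, A.str.base_toBody] at h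
    exact h.symm)
  map_id _ := rfl
  map_comp _ _ := rfl

end CellCx

/-! ### The canonical complex on a single cell -/

namespace SingleCell

open TopCat

/-- The stages `S^{d-1} ⟶ D^d = D^d = ⋯`. -/
noncomputable abbrev obj (d : ℕ) : ℕ → TopCat.{u}
  | 0 => ∂𝔻 d
  | _ + 1 => 𝔻 d

/-- The transition maps between the stages. -/
noncomputable abbrev step (d : ℕ) : ∀ n, obj.{u} d n ⟶ obj.{u} d (n + 1)
  | 0 => diskBoundaryInclusion d
  | _ + 1 => 𝟙 (𝔻 d)

/-- The inclusions of the stages into the body. -/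
noncomputable abbrev toBody (d : ℕ) : ∀ n, obj.{u} d n ⟶ 𝔻 d
  | 0 => diskBoundaryInclusion d
  | _ + 1 => 𝟙 (𝔻 d)

lemma step_toBody (d : ℕ) : ∀ n, step.{u} d n ≫ toBody d (n + 1) = toBody d n
  | 0 => Category.comp_id _
  | _ + 1 => Category.comp_id _

/-- The cells in the stratum `n`: a single one, of shape `d`, for `n = 0`. -/
inductive Cells (d : ℕ) : ℕ → ℕ → Type u
  | mk : Cells d 0 d

/-- The sequence of stages as a functor. -/
noncomputable def stage (d : ℕ) : ℕ ⥤ TopCat.{u} := Functor.ofSequence (step d)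

lemma stage_succ (d n : ℕ) : (stage.{u} d).map (homOfLE n.le_succ) = step d n :=
  Functor.ofSequence_map_homOfLE_succ _ _

/-- The attaching maps. -/
noncomputable def attach {d : ℕ} : ∀ {n e : ℕ}, Cells.{u} d n e → (∂𝔻 e ⟶ obj.{u} d n)
  | _, _, .mk => 𝟙 (∂𝔻 d)

/-- The characteristic maps. -/
noncomputable def char {d : ℕ} : ∀ {n e : ℕ}, Cells.{u} d n e → (𝔻 e ⟶ obj.{u} d (n + 1))
  | _, _, .mk => 𝟙 (𝔻 d)

lemma attach_step {d n e : ℕ} (s : Cells.{u} d n e) :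
    attach s ≫ step d n = diskBoundaryInclusion e ≫ char s := by
  cases s
  exact (Category.id_comp _).trans (Category.comp_id _).symm

lemma isPushout (d n : ℕ) : IsPushout
    (Limits.Sigma.map fun s : Σ e, Cells.{u} d n e => diskBoundaryInclusion.{u} s.1)
    (Limits.Sigma.desc fun s : Σ e, Cells d n e => attach s.2)
    (Limits.Sigma.desc fun s : Σ e, Cells d n e => char s.2) (step.{u} d n) := by
  refine ⟨⟨?_⟩, ⟨PushoutCocone.IsColimit.mk _
    (fun c => match n, c with
      | 0, c => Limits.Sigma.ι (fun s : Σ e, Cells.{u} d 0 e => disk.{u} s.1) ⟨d, .mk⟩ ≫ c.inl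
      | _ + 1, c => c.inr) ?_ ?_ ?_⟩⟩
  · ext1 s
    simp [attach_step]
  · intro c
    ext1 ⟨e, s⟩
    cases s
    simp [char]
  · intro c
    cases n with
    | zero =>
      have h := Limits.Sigma.ι (fun s : Σ e, Cells.{u} d 0 e => diskBoundary.{u} s.1) ⟨d, .mk⟩ ≫= c.condition
      simp [attach] at h
      exact h
    | succ n => exact Category.id_comp _
  · intro c m h₁ h₂
    cases n with
    | zero =>
      have h := Limits.Sigma.ι (fun s : Σ e, Cells.{u} d 0 e => disk.{u} s.1) ⟨d, .mk⟩ ≫= h₁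
      simp [char] at h
      exact h
    | succ n => exact (Category.id_comp _).symm.trans h₂

/-- The height one complex structure with a single cell on `S^{d-1} ⟶ D^d`. -/
noncomputable def str (d : ℕ) : CellStr (diskBoundaryInclusion.{u} d) where
  stage := stage d
  base := Iso.refl _
  stratum n :=
    { cells := Cells d n
      attach := attach
      char := char
      isPushout := by rw [stage_succ]; exact isPushout d n }
  proper := by
    rintro n e ⟨⟩ m h
    exact absurd h (Nat.not_lt_zero m)
  toBody := toBody d
  toBody_naturality {m n} h := by
    induction n, h using Nat.le_induction with
    | base => exact (congrArg (· ≫ toBody d m) ((stage d).map_id m)).trans (Category.id_comp _)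
    | succ n h ih =>
      rw [← homOfLE_comp h n.le_succ, Functor.map_comp, stage_succ]
      exact (Category.assoc _ _ _).trans
        ((congrArg ((stage d).map (homOfLE h) ≫ ·) (step_toBody d n)).trans ih)
  isColimit :=
    { desc := fun c => c.ι.app 1
      fac := fun c n => by
        cases n with
        | zero =>
          have h := c.w (homOfLE (Nat.le_succ 0))
          rw [stage_succ] at h
          exact h
        | succ n =>
          have h : ∀ k, c.ι.app (k + 1) = c.ι.app 1 := by
            intro k
            induction k with
            | zero => rfl
            | succ k ih =>
              have h := c.w (homOfLE (Nat.le_succ (k + 1)))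
              rw [stage_succ] at h
              exact ((Category.id_comp _).symm.trans h).trans ih
          exact (Category.id_comp _).trans (h n).symm
      uniq := fun c m h => (Category.id_comp _).symm.trans (h 1) }
  base_toBody := Category.id_comp _

end SingleCell

namespace CellCx

open TopCat

/-- The canonical functor `J ⥤ CellCx`, sending a generating map to its single-cell complex. -/
noncomputable def unit : Discrete ℕ ⥤ CellCx.{u} :=
  Discrete.functor fun d => ⟨∂𝔻 d, 𝔻 d, diskBoundaryInclusion d, SingleCell.str d⟩

/-- A functor from relative cell complexes to left maps preserves composition if it sends every
composite of two relative cell complexes to the composite of the corresponding left maps. -/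
def PreservesComposition {W : AWFS TopCat.{u}} (F : CellCx.{u} ⥤ W.LMap) : Prop :=
  ∀ {X Y Z : TopCat.{u}} {f : X ⟶ Y} {g : Y ⟶ Z}
    (σ : CellStr f) (τ : CellStr g) (ρ : CellStr (f ≫ g)), σ.IsComposite τ ρ →
    W.IsComposite (F.obj ⟨X, Y, f, σ⟩) (F.obj ⟨Y, Z, g, τ⟩) (F.obj ⟨X, Z, f ≫ g, ρ⟩)

end CellCx

/-!
A left map structure on `k` fills every square from `k` into a free right map `R h`. Call a map into
the domain of `R h` a chosen lift if it is the filler of its own square. Chosen lifts are determined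
by their restriction along `k` and their composite with `R h`, and they are stable under composition
with the maps `M φ`, `μ` and `δ`; stability under `δ` is where the distributive law enters.

Fix left map structures on the generating maps, and call a map out of the body of a relative cell
complex cellular if it is a chosen lift on each cell. Every square from the complex to a free right
map has exactly one cellular filler. The filler of the unit square is a left map structure on the
complex, and coassociativity, functoriality and compatibility with composition all follow from the
uniqueness. Conversely, let a functor over the arrow category preserve composition and restrict to
the given structures. Split a complex at its `n`-th stage. Then each cell of the stratum `n` is a
morphism from a single-cell complex to the upper part, so the left map structure that the functor
assigns to the complex is cellular.

For the existence of composites, the cells of two composable complexes decompose the total body,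
and they are well-founded when the cells of the second complex come after those of the first. A
compact set meets only finitely many open cells, so the boundary of a cell depends on finitely many
other cells. Hence every cell has a finite height, and the skeleta form a proper complex.
-/

/-! ### Chosen lifts into free right maps -/

namespace PreAWFS

variable {C : Type w} [Category.{v} C] (W : PreAWFS C) (h : Arrow C)

lemma δ_app_left : (W.δ.app h).left = 𝟙 h.left :=
  (Category.comp_id _).symm.trans (congrArg CommaMorphism.left (W.left_counit h))

lemma lam_comul : W.lam h ≫ W.comul h = W.lam (W.L.obj h) := by
  have w : (W.δ.app h).left ≫ W.lam (W.L.obj h) = W.lam h ≫ W.comul h := Arrow.w (W.δ.app h)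
  rw [← w, δ_app_left]
  exact Category.id_comp _

lemma comul_rho : W.comul h ≫ W.rho (W.L.obj h) = 𝟙 (W.M.obj h) :=
  congrArg CommaMorphism.right (W.left_counit h)

lemma map_η_mul : W.M.map (W.η.app h) ≫ W.mul h = 𝟙 (W.M.obj h) :=
  congrArg CommaMorphism.left (W.right_unit h)

end PreAWFS

namespace AWFS

variable {C : Type w} [Category.{v} C] {W : AWFS C}

namespace LeftStr

variable {S D : C} {k : S ⟶ D} {h h' : Arrow C}

@[ext]
lemma ext {β γ : W.LeftStr k} (e : β.str = γ.str) : β = γ := by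
  have : β.a = γ.a := Arrow.hom_ext _ _ (β.a_left.trans γ.a_left.symm) e
  cases β
  cases γ
  cases this
  rfl

/-- The left map structure with structure map `s`. -/
def ofStr (s : D ⟶ W.M.obj (Arrow.mk k)) (comp_s : k ≫ s = W.lam (Arrow.mk k))
    (s_rho : s ≫ W.rho (Arrow.mk k) = 𝟙 D)
    (s_comul : s ≫ W.comul (Arrow.mk k) = s ≫ W.M.map (X := Arrow.mk k) (Y := W.L.obj (Arrow.mk k))
      (Arrow.homMk (𝟙 S) s ((Category.id_comp _).trans comp_s.symm))) :
    W.LeftStr k where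
  a := Arrow.homMk (𝟙 S) s ((Category.id_comp _).trans comp_s.symm)
  counit := Arrow.hom_ext _ _ (Category.comp_id _) s_rho
  coassoc := Arrow.hom_ext _ _ (congrArg (𝟙 S ≫ ·) (W.δ_app_left _)) s_comul

variable (β : W.LeftStr k)

/-- The filler, provided by a left map structure on `k`, of a square from `k` to `R h`. -/
def lift (q : Arrow.mk k ⟶ W.R.obj h) : D ⟶ W.M.obj h :=
  β.str ≫ W.M.map q ≫ W.mul h

lemma comp_lift (q : Arrow.mk k ⟶ W.R.obj h) : k ≫ β.lift q = q.left := by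
  have w : W.lam (Arrow.mk k) ≫ W.M.map q = q.left ≫ W.lam (W.R.obj h) :=
    (W.lam_naturality q).symm
  rw [lift, reassoc_of% β.comp_str, reassoc_of% w, PreAWFS.lam_mul]
  exact Category.comp_id _

lemma lift_rho (q : Arrow.mk k ⟶ W.R.obj h) : β.lift q ≫ W.rho h = q.right := by
  have w : W.M.map q ≫ W.rho (W.R.obj h) = W.rho (Arrow.mk k) ≫ q.right := W.rho_naturality q
  rw [lift, Category.assoc, Category.assoc, PreAWFS.mul_rho, w, reassoc_of% β.str_rho]

/-- The square from `k` to `R h` with diagonal `x`. -/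
def square (k : S ⟶ D) (x : D ⟶ W.M.obj h) : Arrow.mk k ⟶ W.R.obj h :=
  Arrow.homMk (k ≫ x) (x ≫ W.rho h) (Category.assoc _ _ _)

/-- A map `x` into the domain of a free right map is a chosen lift if it is the filler which the
left map structure on `k` provides for the square with diagonal `x`. -/
def IsLift (x : D ⟶ W.M.obj h) : Prop := β.lift (square k x) = x

variable {β}

lemma isLift_lift (q : Arrow.mk k ⟶ W.R.obj h) : β.IsLift (β.lift q) := by
  have : square k (β.lift q) = q := Arrow.hom_ext _ _ (β.comp_lift q) (β.lift_rho q)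
  rw [IsLift, this]

lemma IsLift.hom_ext {x y : D ⟶ W.M.obj h} (hx : β.IsLift x) (hy : β.IsLift y)
    (h₁ : k ≫ x = k ≫ y) (h₂ : x ≫ W.rho h = y ≫ W.rho h) : x = y := by
  have : square k x = square k y := Arrow.hom_ext _ _ h₁ h₂
  rw [← hx, ← hy, this]

lemma isLift_str : β.IsLift β.str := by
  have : square k β.str = W.η.app (Arrow.mk k) := Arrow.hom_ext _ _ β.comp_str β.str_rho
  rw [IsLift, lift, this, PreAWFS.map_η_mul]
  exact Category.comp_id _

-- The hypothesis on `φ` says that it is a morphism of free `R`-algebras.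
lemma IsLift.comp_left {x : D ⟶ W.M.obj h} (hx : β.IsLift x) (φ : W.R.obj h ⟶ W.R.obj h')
    (hφ : W.M.map φ ≫ W.mul h' = W.mul h ≫ φ.left) : β.IsLift (x ≫ φ.left) := by
  have : square k (x ≫ φ.left) = square k x ≫ φ := by
    refine Arrow.hom_ext _ _ (Category.assoc _ _ _).symm ?_
    exact (Category.assoc _ _ _).trans
      ((congrArg (x ≫ ·) (Arrow.w φ)).trans (Category.assoc _ _ _).symm)
  rw [IsLift, this, lift, W.M.map_comp, Category.assoc, hφ]
  conv_rhs => rw [← hx, lift]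
  simp only [Category.assoc]

lemma IsLift.map {x : D ⟶ W.M.obj h} (hx : β.IsLift x) (φ : h ⟶ h') :
    β.IsLift (x ≫ W.M.map φ) :=
  hx.comp_left (W.R.map φ) (mul_naturality φ)

lemma IsLift.mul {x : D ⟶ W.M.obj (W.R.obj h)} (hx : β.IsLift x) : β.IsLift (x ≫ W.mul h) :=
  hx.comp_left (W.μ.app h) (congrArg CommaMorphism.left (W.assoc h))

lemma IsLift.comul {x : D ⟶ W.M.obj h} (hx : β.IsLift x) : β.IsLift (x ≫ W.comul h) := by
  have : square k (x ≫ W.comul h) = β.a ≫ W.L.map (square k x) ≫ W.Δ h := by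
    refine Arrow.hom_ext _ _ ?_ ?_
    · change k ≫ x ≫ W.comul h = β.a.left ≫ (k ≫ x) ≫ W.comul h
      rw [β.a_left, Category.assoc]
      exact (Category.id_comp _).symm
    · change (x ≫ W.comul h) ≫ W.rho (W.L.obj h) = β.lift (square k x)
      rw [hx, Category.assoc, PreAWFS.comul_rho]
      exact Category.comp_id _
  rw [IsLift, this, lift, W.M.map_comp, W.M.map_comp]
  conv_rhs => rw [← hx, lift]
  simp only [Category.assoc]
  rw [distrib, ← Category.assoc (W.M.map (square k x)), comul_naturality, Category.assoc,
    reassoc_of% β.str_comul]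

end LeftStr

lemma LMap.exists_toLMap_eq (a : W.LMap) {X Y : C} {f : X ⟶ Y} (e : a.A = Arrow.mk f) :
    ∃ α : W.LeftStr f, α.toLMap = a := by
  obtain ⟨A, a, counit, coassoc⟩ := a
  change A = Arrow.mk f at e
  subst e
  exact ⟨⟨a, counit, coassoc⟩, rfl⟩

lemma LeftStr.toLMap_injective {X Y : C} {f : X ⟶ Y} :
    Function.Injective (toLMap : W.LeftStr f → W.LMap) := by
  intro α β e
  have heq : α.toLMap.a ≍ β.toLMap.a := by rw [e]
  have ha : α.a = β.a := eq_of_heq heq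
  exact LeftStr.ext (congrArg CommaMorphism.right ha)

lemma LeftStr.str_naturality {X Y X' Y' : C} {f : X ⟶ Y} {g : X' ⟶ Y'} {α : W.LeftStr f}
    {β : W.LeftStr g} {a b : W.LMap} (ha : α.toLMap = a) (hb : β.toLMap = b) (m : a ⟶ b)
    (q : Arrow.mk f ⟶ Arrow.mk g) (hq : m.f ≍ q) :
    α.str ≫ W.M.map q = q.right ≫ β.str := by
  subst ha hb
  obtain rfl : m.f = q := eq_of_heq hq
  exact congrArg CommaMorphism.right m.h

/-- The morphism of left maps given by a square that commutes with the structure maps. -/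
def LeftStr.homMk {X Y X' Y' : C} {f : X ⟶ Y} {g : X' ⟶ Y'} {α : W.LeftStr f}
    {β : W.LeftStr g} (q : Arrow.mk f ⟶ Arrow.mk g)
    (hq : α.str ≫ W.M.map q = q.right ≫ β.str) : α.toLMap ⟶ β.toLMap where
  f := q
  h := by
    refine Arrow.hom_ext _ _ ?_ hq
    change α.a.left ≫ q.left = q.left ≫ β.a.left
    rw [α.a_left, β.a_left]
    exact (Category.id_comp _).trans (Category.comp_id _).symm

lemma LMap.hom_heq {a a' b b' : W.LMap} (ha : a = a') (hb : b = b') {m : a ⟶ b} {m' : a' ⟶ b'}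
    (h : m.f ≍ m'.f) : m ≍ m' := by
  subst ha hb
  exact heq_of_eq (Comonad.Coalgebra.Hom.ext (eq_of_heq h))

lemma IsComposite.eq_comp {X Y Z : C} {f : X ⟶ Y} {g : Y ⟶ Z} {α : W.LeftStr f}
    {β : W.LeftStr g} {γ : W.LeftStr (f ≫ g)}
    (H : W.IsComposite α.toLMap β.toLMap γ.toLMap) : γ = α.comp β := by
  generalize ha : α.toLMap = a at H
  generalize hb : β.toLMap = b at H
  generalize hc : γ.toLMap = c at H
  obtain @⟨_, _, _, f', g', α', β'⟩ := H
  have hf : Arrow.mk f = Arrow.mk f' := congrArg Comonad.Coalgebra.A ha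
  have hg : Arrow.mk g = Arrow.mk g' := congrArg Comonad.Coalgebra.A hb
  cases hf
  cases hg
  cases LeftStr.toLMap_injective ha
  cases LeftStr.toLMap_injective hb
  exact LeftStr.toLMap_injective hc

end AWFS

/-! ### The left map structure of a relative cell complex -/

open TopCat

namespace Stratum

variable {X X' : TopCat.{u}} {i : X ⟶ X'} (S : Stratum i)

lemma attach_comp {d : ℕ} (s : S.cells d) :
    S.attach s ≫ i = diskBoundaryInclusion d ≫ S.char s := by
  simpa only [Limits.Sigma.ι_map_assoc, Limits.Sigma.ι_desc, Limits.Sigma.ι_desc_assoc] using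
    (Limits.Sigma.ι (fun s : Σ d, S.cells d => diskBoundary.{u} s.1) ⟨d, s⟩ ≫=
      S.isPushout.w).symm

variable {S} in
lemma hom_ext {T : TopCat.{u}} {a b : X' ⟶ T} (h : i ≫ a = i ≫ b)
    (h' : ∀ d (s : S.cells d), S.char s ≫ a = S.char s ≫ b) : a = b := by
  refine S.isPushout.hom_ext ?_ h
  ext1 ⟨d, s⟩
  simpa only [Limits.Sigma.ι_desc_assoc] using h' d s

lemma exists_desc {T : TopCat.{u}} (a : X ⟶ T) (x : ∀ d, S.cells d → (𝔻 d ⟶ T))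
    (h : ∀ d (s : S.cells d), S.attach s ≫ a = diskBoundaryInclusion d ≫ x d s) :
    ∃ b : X' ⟶ T, i ≫ b = a ∧ ∀ d (s : S.cells d), S.char s ≫ b = x d s := by
  have w : Limits.Sigma.map (fun s : Σ d, S.cells d => diskBoundaryInclusion.{u} s.1) ≫
      Limits.Sigma.desc (fun s : Σ d, S.cells d => x s.1 s.2) =
      Limits.Sigma.desc (fun s : Σ d, S.cells d => S.attach s.2) ≫ a := by
    ext1 ⟨d, s⟩
    simpa only [Limits.Sigma.ι_map_assoc, Limits.Sigma.ι_desc, Limits.Sigma.ι_desc_assoc] using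
      (h d s).symm
  refine ⟨S.isPushout.desc _ a w, S.isPushout.inr_desc _ _ _, fun d s => ?_⟩
  simpa only [Limits.Sigma.ι_desc_assoc, Limits.Sigma.ι_desc] using
    Limits.Sigma.ι (fun s : Σ d, S.cells d => disk.{u} s.1) ⟨d, s⟩ ≫=
      S.isPushout.inl_desc _ a w

variable {W : AWFS TopCat.{u}} (κ : ∀ d, W.LeftStr (diskBoundaryInclusion.{u} d))
  {h : Arrow TopCat.{u}}

lemma exists_isLift (a : X ⟶ W.M.obj h) (y : X' ⟶ h.right) (w : a ≫ W.rho h = i ≫ y) :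
    ∃ b : X' ⟶ W.M.obj h, i ≫ b = a ∧ b ≫ W.rho h = y ∧
      ∀ d (s : S.cells d), (κ d).IsLift (S.char s ≫ b) := by
  let q (d : ℕ) (s : S.cells d) : Arrow.mk (diskBoundaryInclusion d) ⟶ W.R.obj h :=
    Arrow.homMk (S.attach s ≫ a) (S.char s ≫ y) (by
      change (S.attach s ≫ a) ≫ W.rho h = diskBoundaryInclusion d ≫ S.char s ≫ y
      rw [Category.assoc, w, ← Category.assoc, attach_comp, Category.assoc])
  obtain ⟨b, hib, hb⟩ := S.exists_desc a (fun d s => (κ d).lift (q d s))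
    (fun d s => ((κ d).comp_lift (q d s)).symm)
  refine ⟨b, hib, S.hom_ext ?_ fun d s => ?_, fun d s => ?_⟩
  · rw [← Category.assoc, hib, w]
  · rw [← Category.assoc, hb, AWFS.LeftStr.lift_rho]
    rfl
  · rw [hb]
    exact AWFS.LeftStr.isLift_lift _

variable {S κ} in
lemma hom_ext_of_isLift {b b' : X' ⟶ W.M.obj h}
    (hb : ∀ d (s : S.cells d), (κ d).IsLift (S.char s ≫ b))
    (hb' : ∀ d (s : S.cells d), (κ d).IsLift (S.char s ≫ b'))
    (h₁ : i ≫ b = i ≫ b') (h₂ : b ≫ W.rho h = b' ≫ W.rho h) : b = b' := by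
  refine S.hom_ext h₁ fun d s => (hb d s).hom_ext (hb' d s) ?_ ?_
  · rw [← Category.assoc, ← Category.assoc, ← attach_comp, Category.assoc, Category.assoc, h₁]
  · rw [Category.assoc, Category.assoc, h₂]

end Stratum

namespace CellStr

variable {X Y Z : TopCat.{u}} {f : X ⟶ Y} {g : Y ⟶ Z} (σ : CellStr f)

lemma step_toBody (n : ℕ) :
    σ.stage.map (homOfLE n.le_succ) ≫ σ.toBody (n + 1) = σ.toBody n :=
  σ.toBody_naturality n.le_succ

lemma base_inv_comp : σ.base.inv ≫ f = σ.toBody 0 :=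
  σ.base.inv_comp_eq.mpr σ.base_toBody.symm

lemma exists_bodyDesc {T : TopCat.{u}} (a : ∀ n, σ.stage.obj n ⟶ T)
    (ha : ∀ n, σ.stage.map (homOfLE n.le_succ) ≫ a (n + 1) = a n) :
    ∃ b : Y ⟶ T, ∀ n, σ.toBody n ≫ b = a n :=
  ⟨σ.isColimit.desc (Cocone.mk T (NatTrans.ofSequence a fun n =>
    (ha n).trans (Category.comp_id _).symm)), σ.isColimit.fac _⟩

variable {W : AWFS TopCat.{u}} (κ : ∀ d, W.LeftStr (diskBoundaryInclusion.{u} d))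
  {h h' : Arrow TopCat.{u}}

/-- A map from the body of a complex into the domain of a free right map is cellular if it is a
chosen lift on each cell. -/
def IsCellular (t : Y ⟶ W.M.obj h) : Prop :=
  ∀ d (s : σ.Cell d), (κ d).IsLift (σ.charMap s ≫ t)

variable {σ κ}

lemma IsCellular.map {t : Y ⟶ W.M.obj h} (ht : σ.IsCellular κ t) (φ : h ⟶ h') :
    σ.IsCellular κ (t ≫ W.M.map φ) := fun d s => (ht d s).map φ

lemma IsCellular.comul {t : Y ⟶ W.M.obj h} (ht : σ.IsCellular κ t) :
    σ.IsCellular κ (t ≫ W.comul h) := fun d s => (ht d s).comul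

lemma IsCellular.hom_ext {t t' : Y ⟶ W.M.obj h} (ht : σ.IsCellular κ t)
    (ht' : σ.IsCellular κ t') (h₁ : f ≫ t = f ≫ t') (h₂ : t ≫ W.rho h = t' ≫ W.rho h) :
    t = t' := by
  refine σ.isColimit.hom_ext fun n => ?_
  change σ.toBody n ≫ t = σ.toBody n ≫ t'
  induction n with
  | zero => rw [← base_inv_comp, Category.assoc, h₁, Category.assoc]
  | succ n ih =>
    refine (σ.stratum n).hom_ext_of_isLift (κ := κ) (fun d s => ?_) (fun d s => ?_) ?_ ?_
    · simpa only [charMap, Category.assoc] using ht d ⟨n, s⟩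
    · simpa only [charMap, Category.assoc] using ht' d ⟨n, s⟩
    · rw [← Category.assoc, ← Category.assoc, step_toBody, ih]
    · rw [Category.assoc, Category.assoc, h₂]

variable (σ κ)

lemma exists_isCellular (q : Arrow.mk f ⟶ W.R.obj h) :
    ∃ t : Y ⟶ W.M.obj h, f ≫ t = q.left ∧ t ≫ W.rho h = q.right ∧ σ.IsCellular κ t := by
  have w : q.left ≫ W.rho h = f ≫ q.right := Arrow.w q
  have exists_next (n : ℕ)
      (a : { a : σ.stage.obj n ⟶ W.M.obj h // a ≫ W.rho h = σ.toBody n ≫ q.right }) :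
      ∃ b : { b : σ.stage.obj (n + 1) ⟶ W.M.obj h // b ≫ W.rho h = σ.toBody (n + 1) ≫ q.right },
        σ.stage.map (homOfLE n.le_succ) ≫ b.1 = a.1 ∧
        ∀ d (s : (σ.stratum n).cells d), (κ d).IsLift ((σ.stratum n).char s ≫ b.1) := by
    obtain ⟨b, hab, hb, hs⟩ := (σ.stratum n).exists_isLift κ a.1 (σ.toBody (n + 1) ≫ q.right)
      (by rw [a.2, ← step_toBody, Category.assoc])
    exact ⟨⟨b, hb⟩, hab, hs⟩
  choose next next_comp next_isLift using exists_next
  let a : ∀ n, { a : σ.stage.obj n ⟶ W.M.obj h // a ≫ W.rho h = σ.toBody n ≫ q.right } :=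
    fun n => Nat.rec ⟨σ.base.inv ≫ q.left, by
      rw [Category.assoc, w, ← base_inv_comp, Category.assoc]⟩ next n
  obtain ⟨t, ht⟩ := σ.exists_bodyDesc (fun n => (a n).1) (fun n => next_comp n (a n))
  refine ⟨t, ?_, σ.isColimit.hom_ext fun n => ?_, fun d ⟨n, s⟩ => ?_⟩
  · calc f ≫ t
      _ = σ.base.hom ≫ σ.toBody 0 ≫ t := by rw [← Category.assoc, σ.base_toBody]
      _ = q.left := by
        rw [ht]
        exact σ.base.hom_inv_id_assoc _
  · change σ.toBody n ≫ t ≫ W.rho h = _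
    rw [← Category.assoc, ht, (a n).2]
  · rw [charMap, Category.assoc, ht]
    exact next_isLift n (a n) d s

lemma exists_leftStr_isCellular : ∃ α : W.LeftStr f, σ.IsCellular κ α.str := by
  obtain ⟨s, comp_s, s_rho, hs⟩ := σ.exists_isCellular κ (W.η.app (Arrow.mk f))
  change f ≫ s = W.lam (Arrow.mk f) at comp_s
  change s ≫ W.rho (Arrow.mk f) = 𝟙 Y at s_rho
  refine ⟨.ofStr s comp_s s_rho (hs.comul.hom_ext (hs.map _) ?_ ?_), hs⟩
  · rw [reassoc_of% comp_s, reassoc_of% comp_s, PreAWFS.lam_comul, ← W.lam_naturality]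
    exact (Category.id_comp _).symm
  · rw [Category.assoc, Category.assoc, PreAWFS.comul_rho, W.rho_naturality, ← Category.assoc]
    exact (Category.comp_id s).trans (congrArg (· ≫ s) s_rho).symm

/-- The left map structure of a relative cell complex determined by left map structures on the
generating maps: the one whose structure map is cellular. -/
noncomputable def leftStr : W.LeftStr f := (σ.exists_leftStr_isCellular κ).choose

variable {σ κ}

lemma isCellular_leftStr : σ.IsCellular κ (σ.leftStr κ).str :=
  (σ.exists_leftStr_isCellular κ).choose_spec

lemma leftStr_eq {α : W.LeftStr f} (hα : σ.IsCellular κ α.str) : σ.leftStr κ = α :=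
  AWFS.LeftStr.ext (isCellular_leftStr.hom_ext hα
    ((σ.leftStr κ).comp_str.trans α.comp_str.symm) ((σ.leftStr κ).str_rho.trans α.str_rho.symm))

lemma leftStr_naturality {X' Y' : TopCat.{u}} {f' : X' ⟶ Y'} {σ' : CellStr f'}
    (q : Arrow.mk f ⟶ Arrow.mk f')
    (hq : ∀ d (s : σ.Cell d), ∃ s', σ.charMap s ≫ q.right = σ'.charMap s') :
    (σ.leftStr κ).str ≫ W.M.map q = q.right ≫ (σ'.leftStr κ).str := by
  have w : q.left ≫ f' = f ≫ q.right := Arrow.w q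
  refine (isCellular_leftStr.map q).hom_ext (fun d s => ?_) ?_ ?_
  · obtain ⟨s', hs'⟩ := hq d s
    rw [← Category.assoc, hs']
    exact isCellular_leftStr d s'
  · calc f ≫ (σ.leftStr κ).str ≫ W.M.map q
      _ = q.left ≫ W.lam (Arrow.mk f') := by
        rw [reassoc_of% (σ.leftStr κ).comp_str, ← W.lam_naturality]
      _ = f ≫ q.right ≫ (σ'.leftStr κ).str := by
        rw [← (σ'.leftStr κ).comp_str, reassoc_of% w]
  · calc ((σ.leftStr κ).str ≫ W.M.map q) ≫ W.rho (Arrow.mk f')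
      _ = q.right := by
        rw [Category.assoc, W.rho_naturality, reassoc_of% (σ.leftStr κ).str_rho]
      _ = (q.right ≫ (σ'.leftStr κ).str) ≫ W.rho (Arrow.mk f') := by
        rw [Category.assoc, (σ'.leftStr κ).str_rho]
        exact (Category.comp_id _).symm

lemma IsComposite.leftStr_eq {τ : CellStr g} {ρ : CellStr (f ≫ g)} (H : σ.IsComposite τ ρ) :
    ρ.leftStr κ = (σ.leftStr κ).comp (τ.leftStr κ) := by
  obtain ⟨e, hσ, hτ⟩ := H
  refine CellStr.leftStr_eq fun d s => ?_
  change (κ d).IsLift (_ ≫ (σ.leftStr κ).compStr (τ.leftStr κ))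
  obtain ⟨s | s, rfl⟩ := (e d).surjective s
  · rw [hσ, Category.assoc, AWFS.LeftStr.comp_compStr', ← Category.assoc]
    exact (isCellular_leftStr d s).map _
  · rw [hτ, AWFS.LeftStr.compStr, ← Category.assoc, ← Category.assoc]
    exact ((isCellular_leftStr d s).map _).mul

end CellStr

namespace CellCx

variable {W : AWFS TopCat.{u}} (κ : ∀ d, W.LeftStr (diskBoundaryInclusion.{u} d))

lemma Hom.charMap_right {A B : CellCx.{u}} (φ : A ⟶ B) {n d : ℕ}
    (s : (A.str.stratum n).cells d) :
    A.str.charMap ⟨n, s⟩ ≫ Hom.right φ = B.str.charMap ⟨n, Hom.cellMap φ n d s⟩ := by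
  rw [CellStr.charMap, CellStr.charMap, Category.assoc, φ.toBody_right, ← Category.assoc,
    φ.char_stageMap]

/-- The functor from relative cell complexes to left maps determined by left map structures on the
generating maps. -/
noncomputable def toLMap : CellCx.{u} ⥤ W.LMap where
  obj A := (A.str.leftStr κ).toLMap
  map φ := AWFS.LeftStr.homMk (U.map φ)
    (CellStr.leftStr_naturality (U.map φ) fun _ s => ⟨_, Hom.charMap_right φ s.2⟩)

lemma toLMap_preservesComposition : PreservesComposition (toLMap κ) := by
  intro X Y Z f g σ τ ρ H
  change W.IsComposite (σ.leftStr κ).toLMap (τ.leftStr κ).toLMap (ρ.leftStr κ).toLMap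
  rw [H.leftStr_eq]
  exact .mk _ _

lemma leftStr_singleCell (d : ℕ) : (SingleCell.str.{u} d).leftStr κ = κ d := by
  refine CellStr.leftStr_eq ?_
  rintro e ⟨n, ⟨⟩⟩
  have : (SingleCell.str d).charMap ⟨0, .mk⟩ = 𝟙 (𝔻 d) := Category.comp_id _
  rw [this, Category.id_comp]
  exact AWFS.LeftStr.isLift_str

end CellCx

/-! ### Cell decompositions -/

/-- The interior of the disk. -/
noncomputable def openDisk (d : ℕ) : Set (𝔻 d) := (Set.range (diskBoundaryInclusion.{u} d))ᶜ

section

variable {X Y Z T : TopCat.{u}} {S S' : ℕ → Type u} {f : X ⟶ Y} {g : Y ⟶ Z}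
  {char : ∀ d, S d → (𝔻 d ⟶ Y)}

/-- The map to `Y` from the disjoint union of the base `X` and of the interiors of the cells. -/
noncomputable def decompositionMap (f : X ⟶ Y) (char : ∀ d, S d → (𝔻 d ⟶ Y)) :
    (X ⊕ Σ c : Σ d, S d, openDisk.{u} c.1) → Y :=
  Sum.elim f fun p => char p.1.1 p.1.2 p.2

/-- The map `f : X ⟶ Y` and the characteristic maps `char` exhibit `Y` as built from `X` by gluing
cells, possibly in infinitely many steps: each point of `Y` is a point of `X` or lies in the
interior of a cell, in a unique way, and `Y` carries the final topology. The cells are graded by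
their dimension. -/
structure IsCellDecomposition (f : X ⟶ Y) (char : ∀ d, S d → (𝔻 d ⟶ Y)) : Prop where
  bijective : Function.Bijective (decompositionMap f char)
  isClosed_of {A : Set Y} (hf : IsClosed (f ⁻¹' A))
    (hchar : ∀ d (s : S d), IsClosed (char d s ⁻¹' A)) : IsClosed A

namespace IsCellDecomposition

lemma mem_range_or_exists_char_eq (h : IsCellDecomposition f char) (y : Y) :
    (∃ x, f x = y) ∨ ∃ d, ∃ s : S d, ∃ p ∈ openDisk d, char d s p = y := by
  obtain ⟨x | ⟨⟨d, s⟩, p⟩, rfl⟩ := h.bijective.2 y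
  · exact .inl ⟨x, rfl⟩
  · exact .inr ⟨d, s, p, p.2, rfl⟩

lemma injective (h : IsCellDecomposition f char) : Function.Injective f :=
  h.bijective.1.comp Sum.inl_injective

lemma base_ne_char (h : IsCellDecomposition f char) (x : X) {d : ℕ} (s : S d) {p : 𝔻 d}
    (hp : p ∈ openDisk d) : f x ≠ char d s p :=
  fun e => Sum.inl_ne_inr (h.bijective.1 (a₁ := .inl x) (a₂ := .inr ⟨⟨d, s⟩, p, hp⟩) e)

lemma char_inj (h : IsCellDecomposition f char) {d d' : ℕ} {s : S d} {s' : S d'} {p : 𝔻 d}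
    {p' : 𝔻 d'} (hp : p ∈ openDisk d) (hp' : p' ∈ openDisk d') (e : char d s p = char d' s' p') :
    (⟨⟨d, s⟩, p⟩ : Σ c : Σ d, S d, 𝔻 c.1) = ⟨⟨d', s'⟩, p'⟩ := by
  have := h.bijective.1 (a₁ := .inr ⟨⟨d, s⟩, p, hp⟩) (a₂ := .inr ⟨⟨d', s'⟩, p', hp'⟩) e
  cases this
  rfl

lemma of_isIso (f : X ⟶ Y) [IsIso f] [∀ d, IsEmpty (S d)] (char : ∀ d, S d → (𝔻 d ⟶ Y)) :
    IsCellDecomposition f char := by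
  have hf := (TopCat.isIso_iff_isHomeomorph f).mp ‹_›
  refine ⟨⟨?_, fun y => ?_⟩, fun hA _ => ?_⟩
  · rintro (x | ⟨⟨d, s⟩, p⟩) (x' | ⟨⟨d', s'⟩, p'⟩) e
    · exact congrArg _ (hf.injective e)
    all_goals exact isEmptyElim ‹S _›
  · obtain ⟨x, rfl⟩ := hf.surjective y
    exact ⟨.inl x, rfl⟩
  · exact hf.isQuotientMap.isClosed_preimage.mp hA

lemma comp {charT : ∀ d, S' d → (𝔻 d ⟶ Z)} (hf : IsCellDecomposition f char)
    (hg : IsCellDecomposition g charT) :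
    IsCellDecomposition (f ≫ g) fun d => Sum.elim (fun s => char d s ≫ g) (charT d) := by
  let e : (X ⊕ Σ c : Σ d, S d ⊕ S' d, openDisk.{u} c.1) ≃
      (X ⊕ Σ c : Σ d, S d, openDisk.{u} c.1) ⊕ Σ c : Σ d, S' d, openDisk.{u} c.1 :=
    { toFun
      | .inl x => .inl (.inl x)
      | .inr ⟨⟨d, .inl s⟩, p⟩ => .inl (.inr ⟨⟨d, s⟩, p⟩)
      | .inr ⟨⟨d, .inr t⟩, p⟩ => .inr ⟨⟨d, t⟩, p⟩
      invFun
      | .inl (.inl x) => .inl x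
      | .inl (.inr ⟨⟨d, s⟩, p⟩) => .inr ⟨⟨d, .inl s⟩, p⟩
      | .inr ⟨⟨d, t⟩, p⟩ => .inr ⟨⟨d, .inr t⟩, p⟩
      left_inv := by rintro (x | ⟨⟨d, s | t⟩, p⟩) <;> rfl
      right_inv := by rintro ((x | ⟨⟨d, s⟩, p⟩) | ⟨⟨d, t⟩, p⟩) <;> rfl }
  have comp_e : decompositionMap (f ≫ g) (fun d => Sum.elim (fun s => char d s ≫ g) (charT d)) =
      decompositionMap g charT ∘ Sum.map (decompositionMap f char) id ∘ e := by
    funext z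
    rcases z with x | ⟨⟨d, s | t⟩, p⟩ <;> rfl
  constructor
  · rw [comp_e]
    exact hg.bijective.comp
      ((Sum.map_bijective.mpr ⟨hf.bijective, Function.bijective_id⟩).comp e.bijective)
  · intro A hA hchar
    exact hg.isClosed_of (hf.isClosed_of hA fun d s => hchar d (.inl s)) fun d t => hchar d (.inr t)

lemma reindex {char' : ∀ d, S' d → (𝔻 d ⟶ Y)} (h : IsCellDecomposition f char)
    (e : ∀ d, S d ≃ S' d) (he : ∀ d s, char' d (e d s) = char d s) :
    IsCellDecomposition f char' := by
  let e' : (X ⊕ Σ c : Σ d, S d, openDisk.{u} c.1) ≃ X ⊕ Σ c : Σ d, S' d, openDisk.{u} c.1 :=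
    Equiv.sumCongr (Equiv.refl X)
      { toFun p := ⟨⟨p.1.1, e _ p.1.2⟩, p.2⟩
        invFun p := ⟨⟨p.1.1, (e _).symm p.1.2⟩, p.2⟩
        left_inv := by rintro ⟨⟨d, s⟩, p⟩; simp
        right_inv := by rintro ⟨⟨d, s⟩, p⟩; simp }
  have comp_e : decompositionMap f char' ∘ e' = decompositionMap f char := by
    funext z
    rcases z with x | ⟨⟨d, s⟩, p⟩
    · rfl
    · exact congrArg (fun a : 𝔻 d ⟶ Y => a p) (he d s)
  constructor
  · rw [← e'.bijective.of_comp_iff, comp_e]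
    exact h.bijective
  · intro A hA hchar
    exact h.isClosed_of hA fun d s => by simpa only [he] using hchar d (e d s)

end IsCellDecomposition

/-- A function, as a map into an indiscrete space; in this way the universal property of a pushout
of spaces also applies to discontinuous functions. -/
def toIndiscrete {P : Type u} (a : X → P) : X ⟶ trivial.obj P :=
  @TopCat.ofHom _ _ _ ⊤ (@ContinuousMap.mk _ _ _ ⊤ a continuous_top)

namespace Stratum

variable {i : X ⟶ Y}

lemma isClosed_of (S : Stratum i) {A : Set Y} (hi : IsClosed (i ⁻¹' A))
    (hchar : ∀ d (s : S.cells d), IsClosed (S.char s ⁻¹' A)) : IsClosed A := by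
  have hdisks : IsClosed (Limits.Sigma.desc (fun s : Σ d, S.cells d => S.char s.2) ⁻¹' A) := by
    refine (isClosed_iff_of_isColimit _
      (coproductIsCoproduct fun s : Σ d, S.cells d => 𝔻 s.1) _).mpr fun ⟨⟨d, s⟩⟩ => ?_
    have hs := hchar d s
    rw [← Limits.Sigma.ι_desc (fun s : Σ d, S.cells d => S.char s.2) ⟨d, s⟩] at hs
    exact hs
  refine (isClosed_iff_of_isColimit _ S.isPushout.isColimit A).mpr ?_
  have hleft := hdisks.preimage (Limits.Sigma.map fun s : Σ d, S.cells d =>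
    diskBoundaryInclusion.{u} s.1).hom.continuous
  rintro (_ | _ | _)
  exacts [hleft, hdisks, hi]

open Classical in
/-- The point of the base or of an open cell that corresponds to a point of the disk of the cell
`s`: a boundary point is sent to the base by the attaching map. -/
noncomputable def decomposeDisk (S : Stratum i) {d : ℕ} (s : S.cells d) (p : 𝔻 d) :
    X ⊕ Σ c : Σ d, S.cells d, openDisk.{u} c.1 :=
  if hp : p ∈ openDisk d then .inr ⟨⟨d, s⟩, p, hp⟩
  else .inl (S.attach s (of_not_not hp : p ∈ Set.range (diskBoundaryInclusion d)).choose)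

lemma decomposeDisk_boundary (S : Stratum i) {d : ℕ} (s : S.cells d) (b : ∂𝔻 d) :
    S.decomposeDisk s (diskBoundaryInclusion d b) = .inl (S.attach s b) := by
  have inj := (mono_iff_injective (diskBoundaryInclusion.{u} d)).mp inferInstance
  have hb : diskBoundaryInclusion d b ∉ openDisk d := not_not_intro ⟨b, rfl⟩
  rw [decomposeDisk, dif_neg hb]
  congr
  exact inj (of_not_not hb).choose_spec

lemma decompositionMap_decomposeDisk (S : Stratum i) {d : ℕ} (s : S.cells d) (p : 𝔻 d) :
    decompositionMap i (fun _ => S.char) (S.decomposeDisk s p) = S.char s p := by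
  by_cases hp : p ∈ openDisk d
  · rw [decomposeDisk, dif_pos hp]
    rfl
  · obtain ⟨b, rfl⟩ := of_not_not hp
    rw [decomposeDisk_boundary]
    exact ConcreteCategory.congr_hom (S.attach_comp s) b

lemma isCellDecomposition (S : Stratum i) : IsCellDecomposition i fun _ => S.char := by
  obtain ⟨t, ht, htchar⟩ := S.exists_desc (toIndiscrete Sum.inl)
    (fun _ s => toIndiscrete (S.decomposeDisk s)) fun d s => by
      ext b
      exact (S.decomposeDisk_boundary s b).symm
  refine ⟨Function.bijective_iff_has_inverse.mpr ⟨t, ?_, ?_⟩, S.isClosed_of⟩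
  · rintro (x | ⟨⟨d, s⟩, p⟩)
    · exact ConcreteCategory.congr_hom ht x
    · exact (ConcreteCategory.congr_hom (htchar d s) p.1).trans (dif_pos p.2)
  · have : t ≫ toIndiscrete (decompositionMap i fun _ => S.char) = toIndiscrete id := by
      refine S.hom_ext ?_ fun d s => ?_
      · rw [← Category.assoc, ht]
        rfl
      · rw [← Category.assoc, htchar]
        ext p
        exact S.decompositionMap_decomposeDisk s p
    exact fun y => ConcreteCategory.congr_hom this y

end Stratum

namespace IsCellDecomposition

variable {i : X ⟶ Y} {char : ∀ d, S d → (𝔻 d ⟶ Y)} {attach : ∀ d, S d → (∂𝔻 d ⟶ X)}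

lemma exists_desc (h : IsCellDecomposition i char)
    (w : ∀ d s, attach d s ≫ i = diskBoundaryInclusion d ≫ char d s)
    (a : X ⟶ T) (x : ∀ d, S d → (𝔻 d ⟶ T))
    (hax : ∀ d s, attach d s ≫ a = diskBoundaryInclusion d ≫ x d s) :
    ∃ b : Y ⟶ T, i ≫ b = a ∧ ∀ d s, char d s ≫ b = x d s := by
  let e := Equiv.ofBijective _ h.bijective
  let t (y : Y) : T := Sum.elim a (fun p => x p.1.1 p.1.2 p.2) (e.symm y)
  have t_base (y : X) : t (i y) = a y := by
    simp only [t, show e.symm (i y) = .inl y from e.symm_apply_eq.mpr rfl, Sum.elim_inl]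
  have t_char (d : ℕ) (s : S d) (p : 𝔻 d) : t (char d s p) = x d s p := by
    by_cases hp : p ∈ openDisk d
    · simp only [t, show e.symm (char d s p) = .inr ⟨⟨d, s⟩, p, hp⟩ from e.symm_apply_eq.mpr rfl,
        Sum.elim_inr]
    · obtain ⟨b, rfl⟩ := of_not_not hp
      have hw : i (attach d s b) = char d s (diskBoundaryInclusion d b) :=
        ConcreteCategory.congr_hom (w d s) b
      rw [← hw, t_base]
      exact ConcreteCategory.congr_hom (hax d s) b
  have continuous_t : Continuous t := continuous_iff_isClosed.mpr fun A hA => by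
    refine h.isClosed_of ?_ fun d s => ?_
    · rw [← Set.preimage_comp, show t ∘ i = a from funext t_base]
      exact hA.preimage a.hom.continuous
    · rw [← Set.preimage_comp, show t ∘ char d s = x d s from funext (t_char d s)]
      exact hA.preimage (x d s).hom.continuous
  exact ⟨ofHom ⟨t, continuous_t⟩, TopCat.ext t_base, fun d s => TopCat.ext (t_char d s)⟩

lemma hom_ext (h : IsCellDecomposition i char) {b b' : Y ⟶ T} (hi : i ≫ b = i ≫ b')
    (hchar : ∀ d s, char d s ≫ b = char d s ≫ b') : b = b' := by
  ext y
  obtain ⟨x, rfl⟩ | ⟨d, s, p, -, rfl⟩ := h.mem_range_or_exists_char_eq y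
  · exact ConcreteCategory.congr_hom hi x
  · exact ConcreteCategory.congr_hom (hchar d s) p

lemma isPushout (h : IsCellDecomposition i char)
    (w : ∀ d s, attach d s ≫ i = diskBoundaryInclusion d ≫ char d s) : IsPushout
    (Limits.Sigma.map fun s : Σ d, S d => diskBoundaryInclusion.{u} s.1)
    (Limits.Sigma.desc fun s : Σ d, S d => attach s.1 s.2)
    (Limits.Sigma.desc fun s : Σ d, S d => char s.1 s.2) i := by
  have exists_lift (c : PushoutCocone
      (Limits.Sigma.map fun s : Σ d, S d => diskBoundaryInclusion.{u} s.1)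
      (Limits.Sigma.desc fun s : Σ d, S d => attach s.1 s.2)) :=
    h.exists_desc w c.inr (fun d s => Limits.Sigma.ι (fun s : Σ d, S d => 𝔻 s.1) ⟨d, s⟩ ≫ c.inl)
      fun d s => by
        have := Limits.Sigma.ι (fun s : Σ d, S d => ∂𝔻 s.1) ⟨d, s⟩ ≫= c.condition
        rw [← Category.assoc, ← Category.assoc, Limits.Sigma.ι_map, Limits.Sigma.ι_desc] at this
        exact (this.symm.trans (Category.assoc _ _ _))
  choose b hib hchar using exists_lift
  refine ⟨⟨?_⟩, ⟨PushoutCocone.IsColimit.mk _ b (fun c => ?_) hib fun c m hl hr => ?_⟩⟩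
  · ext1 ⟨d, s⟩
    simpa only [Limits.Sigma.ι_map_assoc, Limits.Sigma.ι_desc, Limits.Sigma.ι_desc_assoc] using
      (w d s).symm
  · ext1 ⟨d, s⟩
    simpa only [Limits.Sigma.ι_desc_assoc] using hchar c d s
  · refine h.hom_ext (hr.trans (hib c).symm) fun d s => ?_
    rw [hchar, ← hl, Limits.Sigma.ι_desc_assoc]

end IsCellDecomposition

end

/-! ### Systems of cells in a well-founded order -/

instance (d : ℕ) : T2Space (disk.{u} d) :=
  inferInstanceAs (T2Space (ULift (Metric.closedBall (0 : EuclideanSpace ℝ (Fin d)) 1)))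

lemma isClosed_of_finite_inter_openDisk {d : ℕ} {B : Set (disk.{u} d)}
    (hB : IsClosed (diskBoundaryInclusion d ⁻¹' B)) (hB' : (B ∩ openDisk d).Finite) :
    IsClosed B := by
  rw [← Set.inter_union_compl B (openDisk d), openDisk, compl_compl,
    ← Set.image_preimage_eq_inter_range]
  exact hB'.isClosed.union ((diskBoundaryInclusion d).hom.continuous.isClosedMap _ hB)

/-- A cell decomposition of `Z` over `f : X ⟶ Z` in which the cells can be glued one after the
other: they are well-founded by a relation `lower`, and each cell is attached to the union of the
image of `X` and of the lower cells, with its final topology. Unlike in a relative cell complex, the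
order in which the cells are glued may be transfinite. -/
structure CellSystem {X Z : TopCat.{u}} (f : X ⟶ Z) where
  cells : ℕ → Type u
  char {d : ℕ} (c : cells d) : 𝔻 d ⟶ Z
  isCellDecomposition : IsCellDecomposition f fun _ => char
  lower : (Σ d, cells d) → (Σ d, cells d) → Prop
  wf : WellFounded lower
  lower_of_boundary {c c' : Σ d, cells d} {b : ∂𝔻 c.1} {p : 𝔻 c'.1} (hp : p ∈ openDisk c'.1) :
    char c'.2 p = char c.2 (diskBoundaryInclusion c.1 b) → lower c' c
  isClosed_boundary {A : Set Z} (c : Σ d, cells d) (hf : IsClosed (f ⁻¹' A))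
    (hlower : ∀ c', lower c' c → IsClosed (char c'.2 ⁻¹' A)) :
    IsClosed ((diskBoundaryInclusion c.1 ≫ char c.2) ⁻¹' A)

namespace CellSystem

variable {X Z : TopCat.{u}} {f : X ⟶ Z} (S : CellSystem f)

/-- The type of all cells, of any dimension. -/
abbrev Cell : Type u := Σ d, S.cells d

/-- The image in `Z` of the interior of a cell. -/
def openCell (c : S.Cell) : Set Z := S.char c.2 '' openDisk c.1

/-- The image in `Z` of the boundary of a cell. -/
def boundary (c : S.Cell) : Set Z := Set.range (diskBoundaryInclusion c.1 ≫ S.char c.2)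

lemma range_char (c : S.Cell) : Set.range (S.char c.2) = S.openCell c ∪ S.boundary c := by
  have : S.boundary c = S.char c.2 '' (openDisk c.1)ᶜ := by
    rw [openDisk, compl_compl, ← Set.range_comp]
    rfl
  rw [this, openCell, ← Set.image_union, Set.union_compl_self, Set.image_univ]

lemma disjoint_range_openCell (c : S.Cell) : Disjoint (Set.range f) (S.openCell c) := by
  rw [Set.disjoint_left]
  rintro _ ⟨x, rfl⟩ ⟨p, hp, e⟩
  exact S.isCellDecomposition.base_ne_char x c.2 hp e.symm

lemma pairwise_disjoint_openCell : Pairwise (Function.onFun Disjoint S.openCell) := by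
  intro c c' hne
  refine Set.disjoint_left.mpr ?_
  rintro _ ⟨p, hp, rfl⟩ ⟨p', hp', e⟩
  exact hne (congrArg Sigma.fst (S.isCellDecomposition.char_inj hp hp' e.symm))

lemma eq_of_mem_openCell {c c' : S.Cell} {z : Z} (h : z ∈ S.openCell c) (h' : z ∈ S.openCell c') :
    c = c' :=
  S.pairwise_disjoint_openCell.eq (Set.not_disjoint_iff.mpr ⟨z, h, h'⟩)

lemma mem_range_or_exists_mem_openCell (z : Z) : z ∈ Set.range f ∨ ∃ c, z ∈ S.openCell c := by
  obtain h | ⟨d, c, p, hp, rfl⟩ := S.isCellDecomposition.mem_range_or_exists_char_eq z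
  · exact .inl h
  · exact .inr ⟨⟨d, c⟩, p, hp, rfl⟩

lemma isClosed_of {A : Set Z} (hf : IsClosed (f ⁻¹' A))
    (hA : ∀ c : S.Cell, IsClosed (S.char c.2 ⁻¹' A) ∨ (A ∩ S.openCell c).Finite) : IsClosed A := by
  suffices h : ∀ c : S.Cell, IsClosed (S.char c.2 ⁻¹' A) from
    S.isCellDecomposition.isClosed_of hf fun d c => h ⟨d, c⟩
  intro c
  induction c using S.wf.induction with
  | _ c ih =>
    refine (hA c).elim id fun hfin => ?_
    refine isClosed_of_finite_inter_openDisk (S.isClosed_boundary c hf ih) ?_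
    refine Set.Finite.of_finite_image (hfin.subset ?_) (f := S.char c.2) fun p hp p' hp' e => ?_
    · rintro _ ⟨p, ⟨hpA, hp⟩, rfl⟩
      exact ⟨hpA, p, hp, rfl⟩
    · exact eq_of_heq (Sigma.mk.inj (S.isCellDecomposition.char_inj hp.2 hp'.2 e)).2

lemma isClosed_of_disjoint_of_finite {A : Set Z} (hf : Disjoint (Set.range f) A)
    (hA : ∀ c, (A ∩ S.openCell c).Finite) : IsClosed A :=
  S.isClosed_of (Set.preimage_eq_empty hf.symm ▸ isClosed_empty) fun c => .inr (hA c)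

lemma finite_of_isCompact {K : Set Z} (hK : IsCompact K) :
    {c | (K ∩ S.openCell c).Nonempty}.Finite := by
  choose z hzK hz using fun c : {c | (K ∩ S.openCell c).Nonempty} => c.2
  have z_injective : Function.Injective z := fun c c' e =>
    Subtype.ext (S.eq_of_mem_openCell (hz c) (e ▸ hz c'))
  have isClosed_of_subset {Q : Set Z} (hQ : Q ⊆ Set.range z) : IsClosed Q := by
    refine S.isClosed_of_disjoint_of_finite ?_ fun c => Set.Subsingleton.finite ?_
    · rw [Set.disjoint_right]
      intro y hy hy'
      obtain ⟨c, rfl⟩ := hQ hy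
      exact Set.disjoint_left.mp (S.disjoint_range_openCell c) hy' (hz c)
    · rintro y ⟨hy, hyc⟩ y' ⟨hy', hyc'⟩
      obtain ⟨c₁, rfl⟩ := hQ hy
      obtain ⟨c₂, rfl⟩ := hQ hy'
      exact congrArg z (Subtype.ext ((S.eq_of_mem_openCell (hz c₁) hyc).trans
        (S.eq_of_mem_openCell (hz c₂) hyc').symm))
  have isDiscrete_range : IsDiscrete (Set.range z) :=
    isDiscrete_iff_forall_mem_exists_isClosed.mpr fun Q hQ =>
      ⟨Q, isClosed_of_subset hQ, Set.inter_eq_left.mpr hQ⟩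
  have finite_range : (Set.range z).Finite :=
    (hK.of_isClosed_subset (isClosed_of_subset subset_rfl)
      (Set.range_subset_iff.mpr hzK)).finite isDiscrete_range
  exact Set.finite_coe_iff.mp ((Set.finite_range_iff z_injective).mp finite_range)

/-- The cells whose interiors meet the boundary of a given cell. -/
def boundaryCells (c : S.Cell) : Set S.Cell := {c' | (S.boundary c ∩ S.openCell c').Nonempty}

lemma finite_boundaryCells (c : S.Cell) : (S.boundaryCells c).Finite :=
  S.finite_of_isCompact (isCompact_range (diskBoundaryInclusion c.1 ≫ S.char c.2).hom.continuous)

lemma lower_of_mem_boundaryCells {c c' : S.Cell} (h : c' ∈ S.boundaryCells c) : S.lower c' c := by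
  obtain ⟨_, ⟨b, rfl⟩, p, hp, e⟩ := h
  exact S.lower_of_boundary hp e

lemma wf_boundaryCells : WellFounded fun c' c => c' ∈ S.boundaryCells c :=
  Subrelation.wf S.lower_of_mem_boundaryCells S.wf

/-- The lowest stage to which a cell can be attached. -/
noncomputable def height : S.Cell → ℕ :=
  S.wf_boundaryCells.fix fun c ih => ⨆ c' : S.boundaryCells c, ih c'.1 c'.2 + 1

lemma height_le_iff {c : S.Cell} {n : ℕ} :
    S.height c ≤ n ↔ ∀ c' ∈ S.boundaryCells c, S.height c' < n := by
  have := (S.finite_boundaryCells c).to_subtype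
  rw [height, WellFounded.fix_eq, ciSup_le_iff' (Set.finite_range _).bddAbove]
  exact Subtype.forall

/-- The union of the image of `X` and of the open cells of height less than `n`. -/
def skeleton (n : ℕ) : Set Z := {z | ∀ c, z ∈ S.openCell c → S.height c < n}

lemma skeleton_mono : Monotone S.skeleton := fun _ _ h _ hz c hc => (hz c hc).trans_le h

lemma range_subset_skeleton (n : ℕ) : Set.range f ⊆ S.skeleton n := fun _ hz c hc =>
  (Set.disjoint_left.mp (S.disjoint_range_openCell c) hz hc).elim

lemma openCell_subset_skeleton {c : S.Cell} {n : ℕ} (h : S.height c < n) :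
    S.openCell c ⊆ S.skeleton n := fun _ hz _ hz' =>
  S.eq_of_mem_openCell hz hz' ▸ h

lemma height_lt_of_mem {c : S.Cell} {z : Z} {n : ℕ} (hz : z ∈ S.openCell c)
    (hz' : z ∈ S.skeleton n) : S.height c < n :=
  hz' c hz

lemma boundary_subset_skeleton_iff {c : S.Cell} {n : ℕ} :
    S.boundary c ⊆ S.skeleton n ↔ S.height c ≤ n :=
  ⟨fun h => S.height_le_iff.mpr fun c' ⟨_, hz, hz'⟩ => h hz c' hz',
    fun h z hz c' hz' => S.height_le_iff.mp h c' ⟨z, hz, hz'⟩⟩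

lemma range_char_subset_skeleton {c : S.Cell} {n : ℕ} (h : S.height c < n) :
    Set.range (S.char c.2) ⊆ S.skeleton n := by
  rw [range_char]
  exact Set.union_subset (S.openCell_subset_skeleton h) (S.boundary_subset_skeleton_iff.mpr h.le)

lemma exists_mem_skeleton (z : Z) : ∃ n, z ∈ S.skeleton n := by
  obtain h | ⟨c, hc⟩ := S.mem_range_or_exists_mem_openCell z
  · exact ⟨0, S.range_subset_skeleton 0 h⟩
  · exact ⟨S.height c + 1, S.openCell_subset_skeleton (Nat.lt_succ_self _) hc⟩

lemma isClosed_of_subset_skeleton {n : ℕ} {A : Set Z} (hA : A ⊆ S.skeleton n)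
    (hf : IsClosed (f ⁻¹' A))
    (hc : ∀ c : S.Cell, S.height c < n → IsClosed (S.char c.2 ⁻¹' A)) : IsClosed A :=
  S.isClosed_of hf fun c => by
    by_cases h : S.height c < n
    · exact .inl (hc c h)
    · refine .inr (Set.finite_empty.subset fun z hz => h (hA hz.1 c hz.2))

end CellSystem

/-! ### The relative cell complex of a system of cells -/

namespace CellSystem

variable {X Z T : TopCat.{u}} {f : X ⟶ Z} (S : CellSystem f) {n : ℕ}

/-- The skeleta as a sequence of spaces. -/
def stage : ℕ ⥤ TopCat.{u} where
  obj n := TopCat.of (S.skeleton n)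
  map h := TopCat.ofHom ⟨Set.inclusion (S.skeleton_mono (leOfHom h)), continuous_inclusion _⟩

/-- The inclusion of a skeleton. -/
def toBody (n : ℕ) : S.stage.obj n ⟶ Z := TopCat.ofHom ⟨Subtype.val, continuous_subtype_val⟩

lemma toBody_injective : Function.Injective (S.toBody n) := Subtype.val_injective

lemma toBody_mem (x : S.stage.obj n) : S.toBody n x ∈ S.skeleton n := x.2

/-- A map into `Z`, as a map into a skeleton that contains its image. -/
def codRestrict (a : T ⟶ Z) (h : Set.range a ⊆ S.skeleton n) : T ⟶ S.stage.obj n :=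
  TopCat.ofHom ⟨fun t => ⟨a t, h ⟨t, rfl⟩⟩, a.hom.continuous.subtype_mk _⟩

lemma isClosed_of_preimage_codRestrict {A : Set (S.stage.obj n)}
    (hf : IsClosed (S.codRestrict f (S.range_subset_skeleton n) ⁻¹' A))
    (hc : ∀ (c : S.Cell) (h : S.height c < n),
      IsClosed (S.codRestrict (S.char c.2) (S.range_char_subset_skeleton h) ⁻¹' A)) :
    IsClosed A := by
  have preimage_image {T : TopCat.{u}} (a : T ⟶ Z) (h : Set.range a ⊆ S.skeleton n) :
      a ⁻¹' (S.toBody n '' A) = S.codRestrict a h ⁻¹' A :=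
    Set.ext fun t => S.toBody_injective.mem_set_image (a := S.codRestrict a h t)
  rw [← Set.preimage_image_eq A S.toBody_injective]
  refine IsClosed.preimage (S.toBody n).hom.continuous
    (S.isClosed_of_subset_skeleton (n := n) ?_ ?_ fun c h => ?_)
  · rintro _ ⟨x, -, rfl⟩
    exact S.toBody_mem x
  · rwa [preimage_image]
  · rw [preimage_image]
    exact hc c h

/-- The cells of height `n`. -/
abbrev newCells (n d : ℕ) : Type u := {c : S.cells d // S.height ⟨d, c⟩ = n}

/-- The attaching map of a cell of height `n`. -/
noncomputable def newAttach (n d : ℕ) (c : S.newCells n d) : ∂𝔻 d ⟶ S.stage.obj n :=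
  S.codRestrict (diskBoundaryInclusion d ≫ S.char c.1)
    (S.boundary_subset_skeleton_iff (c := ⟨d, c.1⟩).mpr c.2.le)

/-- The characteristic map of a cell of height `n`. -/
noncomputable def newChar (n d : ℕ) (c : S.newCells n d) : 𝔻 d ⟶ S.stage.obj (n + 1) :=
  S.codRestrict (S.char c.1)
    (S.range_char_subset_skeleton (c := ⟨d, c.1⟩) (c.2.trans_lt n.lt_succ_self))

lemma isCellDecomposition_stage (n : ℕ) :
    IsCellDecomposition (S.stage.map (homOfLE n.le_succ)) (S.newChar n) := by
  have newChar_notMem {d : ℕ} (c : S.newCells n d) {p : 𝔻 d} (hp : p ∈ openDisk d) :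
      S.char c.1 p ∉ S.skeleton n :=
    fun h => (S.height_lt_of_mem (c := ⟨d, c.1⟩) ⟨p, hp, rfl⟩ h).ne c.2
  refine ⟨⟨?_, fun z => ?_⟩, fun hA hchar => ?_⟩
  · rintro (x | ⟨⟨d, c⟩, p, hp⟩) (x' | ⟨⟨d', c'⟩, p', hp'⟩) e <;>
      replace e := congrArg (S.toBody (n + 1)) e
    · exact congrArg _ (S.toBody_injective e)
    · exact (newChar_notMem c' hp' (Eq.subst (motive := (· ∈ S.skeleton n)) e x.2)).elim
    · exact (newChar_notMem c hp (Eq.subst (motive := (· ∈ S.skeleton n)) e.symm x'.2)).elim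
    · obtain ⟨c, hc⟩ := c
      obtain ⟨c', hc'⟩ := c'
      cases S.isCellDecomposition.bijective.1
        (a₁ := .inr ⟨⟨d, c⟩, p, hp⟩) (a₂ := .inr ⟨⟨d', c'⟩, p', hp'⟩) e
      rfl
  · by_cases hz : S.toBody _ z ∈ S.skeleton n
    · exact ⟨.inl ⟨_, hz⟩, rfl⟩
    · obtain ⟨⟨d, c⟩, hc⟩ := not_forall.mp hz
      obtain ⟨⟨p, hp, e⟩, hn⟩ := Classical.not_imp.mp hc
      have hn' := S.height_lt_of_mem ⟨p, hp, e⟩ (S.toBody_mem z)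
      exact ⟨.inr ⟨⟨d, c, Nat.eq_of_lt_succ_of_not_lt hn' hn⟩, p, hp⟩, S.toBody_injective e⟩
  · refine S.isClosed_of_preimage_codRestrict
      (hA.preimage (S.codRestrict f (S.range_subset_skeleton n)).hom.continuous) fun c hc => ?_
    obtain hc' | hc' := Nat.lt_succ_iff_lt_or_eq.mp hc
    · exact hA.preimage
        (S.codRestrict (S.char c.2) (S.range_char_subset_skeleton hc')).hom.continuous
    · exact hchar c.1 ⟨c.2, hc'⟩

/-- The cells of height `n` form a stratum on the `n`-th skeleton. -/
noncomputable def stratum (n : ℕ) : Stratum (S.stage.map (homOfLE n.le_succ)) where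
  cells := S.newCells n
  attach {d} := S.newAttach n d
  char {d} := S.newChar n d
  isPushout := (S.isCellDecomposition_stage n).isPushout fun _ _ => rfl

lemma isHomeomorph_codRestrict_base :
    IsHomeomorph (S.codRestrict f (S.range_subset_skeleton 0)) := by
  refine isHomeomorph_iff_continuous_isClosedMap_bijective.mpr
    ⟨(S.codRestrict f _).hom.continuous, fun A hA => ?_, fun x x' e => ?_, fun z => ?_⟩
  · refine S.isClosed_of_preimage_codRestrict ?_ fun c hc => absurd hc (Nat.not_lt_zero _)
    rwa [Set.preimage_image_eq]
    exact fun x x' e => S.isCellDecomposition.injective (congrArg (S.toBody 0) e)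
  · exact S.isCellDecomposition.injective (congrArg (S.toBody 0) e)
  · obtain ⟨x, hx⟩ | ⟨c, hc⟩ := S.mem_range_or_exists_mem_openCell (S.toBody 0 z)
    · exact ⟨x, S.toBody_injective hx⟩
    · exact absurd (S.height_lt_of_mem hc (S.toBody_mem z)) (Nat.not_lt_zero _)

lemma existsUnique_bodyDesc (a : ∀ n, S.stage.obj n ⟶ T)
    (ha : ∀ {m n : ℕ} (h : m ≤ n), S.stage.map (homOfLE h) ≫ a n = a m) :
    ∃! b : Z ⟶ T, ∀ n, S.toBody n ≫ b = a n := by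
  choose n hn using S.exists_mem_skeleton
  let t (z : Z) : T := a (n z) ⟨z, hn z⟩
  have t_toBody (m : ℕ) (z : S.stage.obj m) : t (S.toBody m z) = a m z := by
    rcases le_total m (n (S.toBody m z)) with h | h
    · exact ConcreteCategory.congr_hom (ha h) z
    · exact (ConcreteCategory.congr_hom (ha h) ⟨S.toBody m z, hn _⟩).symm
  have continuous_comp {T' : TopCat.{u}} {m : ℕ} (x : T' ⟶ Z) (hx : Set.range x ⊆ S.skeleton m) :
      Continuous (t ∘ x) :=
    (S.codRestrict x hx ≫ a m).hom.continuous.congr fun _ => (t_toBody m _).symm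
  have continuous_t : Continuous t := continuous_iff_isClosed.mpr fun A hA =>
    S.isCellDecomposition.isClosed_of
      (hA.preimage (continuous_comp f (S.range_subset_skeleton 0))) fun d c =>
      hA.preimage (continuous_comp (S.char c)
        (S.range_char_subset_skeleton (c := ⟨d, c⟩) (Nat.lt_succ_self _)))
  exact ⟨TopCat.ofHom ⟨t, continuous_t⟩, fun m => TopCat.ext (t_toBody m), fun b hb =>
    TopCat.ext fun z => ConcreteCategory.congr_hom (hb (n z)) ⟨z, hn z⟩⟩

/-- The relative cell complex in which each cell of the system lies in the lowest possible
stratum. -/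
noncomputable def toCellStr : CellStr f where
  stage := S.stage
  base := isoOfHomeo S.isHomeomorph_codRestrict_base.homeomorph
  stratum := S.stratum
  proper n d c m h := by
    rintro ⟨b, hb⟩
    refine h.not_ge (c.2.ge.trans (S.boundary_subset_skeleton_iff.mp ?_))
    rintro _ ⟨x, rfl⟩
    have e : S.toBody m (b x) = S.char c.1 (diskBoundaryInclusion d x) :=
      congrArg (S.toBody n) (ConcreteCategory.congr_hom hb x)
    exact Eq.subst (motive := (· ∈ S.skeleton m)) e (S.toBody_mem (b x))
  toBody := S.toBody
  toBody_naturality _ := rfl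
  isColimit := IsColimit.ofExistsUnique fun c =>
    S.existsUnique_bodyDesc c.ι.app fun h => c.w (homOfLE h)
  base_toBody := rfl

/-- The cells of the system, as cells of its relative cell complex. -/
noncomputable def cellEquiv (d : ℕ) : S.cells d ≃ S.toCellStr.Cell d :=
  (Equiv.sigmaFiberEquiv fun c : S.cells d => S.height ⟨d, c⟩).symm

end CellSystem

/-! ### The system of cells of a relative cell complex -/

namespace CellStr

variable {X Y : TopCat.{u}} {f : X ⟶ Y} (σ : CellStr f)

lemma stage_map_comp {l m n : ℕ} (h : l ≤ m) (h' : m ≤ n) :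
    σ.stage.map (homOfLE h) ≫ σ.stage.map (homOfLE h') = σ.stage.map (homOfLE (h.trans h')) :=
  (σ.stage.map_comp _ _).symm

/-- The map from the base of a complex to its `n`-th stage. -/
def toStage (n : ℕ) : X ⟶ σ.stage.obj n := σ.base.hom ≫ σ.stage.map (homOfLE n.zero_le)

/-- The cells that are glued before the `n`-th stage. -/
abbrev StageCell (n d : ℕ) : Type u := {c : σ.Cell d // c.1 < n}

/-- The characteristic map of a cell, with values in a stage. -/
noncomputable def stageChar (n d : ℕ) (c : σ.StageCell n d) : 𝔻 d ⟶ σ.stage.obj n :=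
  (σ.stratum c.1.1).char c.1.2 ≫ σ.stage.map (homOfLE c.2)

lemma toStage_toBody (n : ℕ) : σ.toStage n ≫ σ.toBody n = f := by
  rw [toStage, Category.assoc, σ.toBody_naturality, σ.base_toBody]

lemma stageChar_toBody {n d : ℕ} (c : σ.StageCell n d) :
    σ.stageChar n d c ≫ σ.toBody n = σ.charMap c.1 := by
  rw [stageChar, Category.assoc, σ.toBody_naturality]
  rfl

/-- The cells glued before the stage `n + 1` are those glued before the stage `n` and those of the
stratum `n`. -/
def stageCellSuccEquiv (n d : ℕ) :
    σ.StageCell n d ⊕ (σ.stratum n).cells d ≃ σ.StageCell (n + 1) d where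
  toFun := Sum.elim (fun c => ⟨c.1, c.2.trans n.lt_succ_self⟩) fun s => ⟨⟨n, s⟩, n.lt_succ_self⟩
  invFun c := if h : c.1.1 < n then .inl ⟨c.1, h⟩
    else .inr (Nat.eq_of_lt_succ_of_not_lt c.2 h ▸ c.1.2)
  left_inv := by
    rintro (⟨c, hc⟩ | s)
    · exact dif_pos hc
    · exact dif_neg n.lt_irrefl
  right_inv := by
    rintro ⟨⟨m, s⟩, hm⟩
    by_cases h : m < n
    · simp only [dif_pos h, Sum.elim_inl]
    · obtain rfl := Nat.eq_of_lt_succ_of_not_lt hm h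
      simp only [dif_neg h, Sum.elim_inr]

lemma isCellDecomposition_stage (n : ℕ) :
    IsCellDecomposition (σ.toStage n) (σ.stageChar n) := by
  induction n with
  | zero =>
    have (d : ℕ) : IsEmpty (σ.StageCell 0 d) := ⟨fun c => Nat.not_lt_zero _ c.2⟩
    rw [toStage, show σ.stage.map (homOfLE (Nat.zero_le 0)) = 𝟙 _ from σ.stage.map_id 0,
      Category.comp_id]
    exact .of_isIso _ _
  | succ n ih =>
    have h := ih.comp (σ.stratum n).isCellDecomposition
    rw [toStage, Category.assoc, stage_map_comp] at h
    refine h.reindex (σ.stageCellSuccEquiv n) ?_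
    rintro d (⟨⟨m, s⟩, hm⟩ | s)
    · exact ((Category.assoc _ _ _).trans (congrArg (_ ≫ ·) (σ.stage_map_comp _ _))).symm
    · exact (congrArg (_ ≫ ·) (σ.stage.map_id (n + 1))).trans (Category.comp_id _)

lemma isClosed_toBody_preimage {A : Set Y} {n : ℕ} (hf : IsClosed (f ⁻¹' A))
    (hchar : ∀ d (c : σ.StageCell n d), IsClosed (σ.charMap c.1 ⁻¹' A)) :
    IsClosed (σ.toBody n ⁻¹' A) := by
  refine (σ.isCellDecomposition_stage n).isClosed_of ?_ fun d c => ?_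
  · rwa [← Set.preimage_comp, ← TopCat.coe_comp, σ.toStage_toBody]
  · rw [← Set.preimage_comp, ← TopCat.coe_comp, stageChar_toBody]
    exact hchar d c

lemma toBody_injective (n : ℕ) : Function.Injective (σ.toBody n) := fun x x' e => by
  have stage_injective {m : ℕ} (h : n ≤ m) : Function.Injective (σ.stage.map (homOfLE h)) := by
    induction m, h using Nat.le_induction with
    | base =>
      rw [show σ.stage.map (homOfLE le_rfl) = 𝟙 _ from σ.stage.map_id n]
      exact Function.injective_id
    | succ m h ih =>
      rw [← σ.stage_map_comp h m.le_succ]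
      exact (σ.stratum m).isCellDecomposition.injective.comp ih
  obtain ⟨m, i, _, h⟩ := (Concrete.isColimit_rep_eq_iff_exists _ σ.isColimit x x').mp e
  exact stage_injective (leOfHom i) h

lemma isCellDecomposition : IsCellDecomposition f fun _ => σ.charMap := by
  let ι (n : ℕ) : (X ⊕ Σ c : Σ d, σ.StageCell n d, openDisk.{u} c.1) →
      X ⊕ Σ c : Σ d, σ.Cell d, openDisk.{u} c.1 :=
    Sum.map id fun p => ⟨⟨p.1.1, p.1.2.1⟩, p.2⟩
  have toBody_decompositionMap (n : ℕ) (z) : σ.toBody n (decompositionMap (σ.toStage n)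
      (σ.stageChar n) z) = decompositionMap f (fun _ => σ.charMap) (ι n z) := by
    rcases z with x | ⟨⟨d, c⟩, p⟩
    · exact ConcreteCategory.congr_hom (σ.toStage_toBody n) x
    · exact ConcreteCategory.congr_hom (σ.stageChar_toBody c) p.1
  have mem_range_ι (z) : ∃ m, ∀ n, m ≤ n → z ∈ Set.range (ι n) := by
    rcases z with x | ⟨⟨d, c⟩, p⟩
    · exact ⟨0, fun n _ => ⟨.inl x, rfl⟩⟩
    · exact ⟨c.1 + 1, fun n h => ⟨.inr ⟨⟨d, c, h⟩, p⟩, rfl⟩⟩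
  refine ⟨⟨fun z z' e => ?_, fun y => ?_⟩, fun {A} hf hchar => ?_⟩
  · obtain ⟨m, hm⟩ := mem_range_ι z
    obtain ⟨m', hm'⟩ := mem_range_ι z'
    obtain ⟨w, rfl⟩ := hm _ (le_max_left m m')
    obtain ⟨w', rfl⟩ := hm' _ (le_max_right m m')
    rw [← toBody_decompositionMap, ← toBody_decompositionMap] at e
    rw [(σ.isCellDecomposition_stage _).bijective.1 (σ.toBody_injective _ e)]
  · obtain ⟨n, x, rfl⟩ := Concrete.isColimit_exists_rep _ σ.isColimit y
    obtain ⟨z, rfl⟩ := (σ.isCellDecomposition_stage n).bijective.2 x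
    exact ⟨ι n z, (toBody_decompositionMap n z).symm⟩
  · exact (isClosed_iff_of_isColimit _ σ.isColimit A).mpr fun n =>
      σ.isClosed_toBody_preimage hf fun d c => hchar d c.1

lemma boundary_charMap {n d : ℕ} (s : (σ.stratum n).cells d) :
    diskBoundaryInclusion d ≫ σ.charMap ⟨n, s⟩ = (σ.stratum n).attach s ≫ σ.toBody n := by
  rw [charMap, ← Category.assoc, ← (σ.stratum n).attach_comp, Category.assoc, σ.step_toBody]

lemma lt_of_charMap_eq {c c' : Σ d, σ.Cell d} {b : ∂𝔻 c.1} {p : 𝔻 c'.1} (hp : p ∈ openDisk c'.1)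
    (e : σ.charMap c'.2 p = σ.charMap c.2 (diskBoundaryInclusion c.1 b)) : c'.2.1 < c.2.1 := by
  obtain ⟨d, n, s⟩ := c
  have e' : σ.charMap c'.2 p = σ.toBody n ((σ.stratum n).attach s b) :=
    e.trans (ConcreteCategory.congr_hom (σ.boundary_charMap s) b)
  obtain ⟨x, hx⟩ | ⟨d', t, p', hp', hx⟩ :=
    (σ.isCellDecomposition_stage n).mem_range_or_exists_char_eq ((σ.stratum n).attach s b)
  · rw [← hx] at e'
    exact (σ.isCellDecomposition.base_ne_char x c'.2 hp (e'.trans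
      (ConcreteCategory.congr_hom (σ.toStage_toBody n) x)).symm).elim
  · rw [← hx] at e'
    have := σ.isCellDecomposition.char_inj hp hp'
      (e'.trans (ConcreteCategory.congr_hom (σ.stageChar_toBody t) p'))
    exact (congrArg (fun z => z.1.2.1) this).trans_lt t.2

/-- The cells of a relative cell complex, ordered by their strata. -/
noncomputable def toSystem : CellSystem f where
  cells := σ.Cell
  char := σ.charMap
  isCellDecomposition := σ.isCellDecomposition
  lower := InvImage (· < ·) fun c => c.2.1
  wf := InvImage.wf _ wellFounded_lt
  lower_of_boundary := σ.lt_of_charMap_eq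
  isClosed_boundary {A} := by
    rintro ⟨d, n, s⟩ hf hlower
    rw [boundary_charMap]
    exact (σ.isClosed_toBody_preimage hf fun d c => hlower ⟨d, c.1⟩ c.2).preimage
      ((σ.stratum n).attach s).hom.continuous

end CellStr

/-! ### Composites and splittings of relative cell complexes -/

namespace CellSystem

variable {X Y Z : TopCat.{u}} {f : X ⟶ Y} {g : Y ⟶ Z}

/-- The system on `f ≫ g` in which the cells of `T` are glued after those of `S`. -/
noncomputable def comp (S : CellSystem f) (T : CellSystem g) : CellSystem (f ≫ g) where
  cells d := S.cells d ⊕ T.cells d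
  char {d} := Sum.elim (fun c => S.char c ≫ g) T.char
  isCellDecomposition := S.isCellDecomposition.comp T.isCellDecomposition
  lower := InvImage (Sum.Lex S.lower T.lower) (Equiv.sigmaSumDistrib _ _)
  wf := InvImage.wf _ (Sum.lex_wf S.wf T.wf)
  lower_of_boundary := by
    rintro ⟨d, c | c⟩ ⟨d', c' | c'⟩ b p hp e
    · exact .inl (S.lower_of_boundary (c := ⟨d, c⟩) (c' := ⟨d', c'⟩) hp
        (T.isCellDecomposition.injective e))
    · exact (T.isCellDecomposition.base_ne_char _ c' hp e.symm).elim
    · exact .sep _ _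
    · exact .inr (T.lower_of_boundary (c := ⟨d, c⟩) (c' := ⟨d', c'⟩) hp e)
  isClosed_boundary {A} := by
    rintro ⟨d, c | c⟩ hf hlower
    · exact S.isClosed_boundary (A := g ⁻¹' A) ⟨d, c⟩ hf fun c' hc' =>
        hlower ⟨c'.1, .inl c'.2⟩ (.inl hc')
    · exact T.isClosed_boundary ⟨d, c⟩
        (S.isCellDecomposition.isClosed_of (A := g ⁻¹' A) hf fun d' c' =>
          hlower ⟨d', .inl c'⟩ (.sep _ _))
        fun c' hc' => hlower ⟨c'.1, .inr c'.2⟩ (.inr hc')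

end CellSystem

namespace CellStr

variable {X Y Z : TopCat.{u}} {f : X ⟶ Y} {g : Y ⟶ Z}

theorem exists_isComposite (σ : CellStr f) (τ : CellStr g) :
    ∃ ρ : CellStr (f ≫ g), σ.IsComposite τ ρ :=
  ⟨(σ.toSystem.comp τ.toSystem).toCellStr, (σ.toSystem.comp τ.toSystem).cellEquiv,
    fun _ _ => rfl, fun _ _ => rfl⟩

variable (σ : CellStr f)

/-- The cells glued before the `n`-th stage, as a system of cells in that stage. -/
noncomputable def stageSystem (n : ℕ) : CellSystem (σ.toStage n) where
  cells := σ.StageCell n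
  char {d} := σ.stageChar n d
  isCellDecomposition := σ.isCellDecomposition_stage n
  lower := InvImage (· < ·) fun c => c.2.1.1
  wf := InvImage.wf _ wellFounded_lt
  lower_of_boundary {c c' b p} hp e := by
    refine σ.lt_of_charMap_eq (c := ⟨c.1, c.2.1⟩) (c' := ⟨c'.1, c'.2.1⟩) (b := b) hp ?_
    rw [← stageChar_toBody, ← stageChar_toBody]
    exact congrArg (σ.toBody n) e
  isClosed_boundary {A} := by
    rintro ⟨d, ⟨m, s⟩, hm⟩ hf hlower
    change m < n at hm
    have boundary_stageChar : diskBoundaryInclusion d ≫ σ.stageChar n d ⟨⟨m, s⟩, hm⟩ =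
        (σ.stratum m).attach s ≫ σ.stage.map (homOfLE hm.le) := by
      rw [stageChar, ← Category.assoc, ← (σ.stratum m).attach_comp, Category.assoc, stage_map_comp]
    rw [boundary_stageChar]
    refine IsClosed.preimage ((σ.stratum m).attach s).hom.continuous
      ((σ.isCellDecomposition_stage m).isClosed_of
        (A := σ.stage.map (homOfLE hm.le) ⁻¹' A) ?_ fun d c => ?_)
    · rwa [← Set.preimage_comp, ← TopCat.coe_comp, toStage, Category.assoc, stage_map_comp]
    · rw [← Set.preimage_comp, ← TopCat.coe_comp, stageChar, Category.assoc, stage_map_comp]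
      exact hlower ⟨d, c.1, c.2.trans hm⟩ c.2

/-- The part of a complex that lies below a stage. -/
noncomputable def head (n : ℕ) : CellStr (σ.toStage n) := (σ.stageSystem n).toCellStr

lemma existsUnique_tailDesc (n : ℕ) {T : TopCat.{u}} (a : ∀ m, σ.stage.obj (n + m) ⟶ T)
    (ha : ∀ {k l : ℕ} (h : k ≤ l),
      σ.stage.map (homOfLE (Nat.add_le_add_left h n)) ≫ a l = a k) :
    ∃! b : Y ⟶ T, ∀ m, σ.toBody (n + m) ≫ b = a m := by
  obtain ⟨b, hb⟩ := σ.exists_bodyDesc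
    (fun k => σ.stage.map (homOfLE (Nat.le_add_left k n)) ≫ a k) fun k => by
      rw [← ha k.le_succ, ← Category.assoc, ← Category.assoc, stage_map_comp, stage_map_comp]
  refine ⟨b, fun k => (hb (n + k)).trans (ha (Nat.le_add_left k n)), fun b' hb' =>
    σ.isColimit.hom_ext fun k => ?_⟩
  change σ.toBody k ≫ b' = σ.toBody k ≫ b
  rw [hb, ← σ.toBody_naturality (Nat.le_add_left k n), Category.assoc, hb']

/-- The part of a complex that is glued to the `n`-th stage. -/
noncomputable def tail (n : ℕ) : CellStr (σ.toBody n) where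
  stage := (Monotone.functor (f := fun m => n + m) fun _ _ h => Nat.add_le_add_left h n) ⋙ σ.stage
  base := Iso.refl _
  stratum m := σ.stratum (n + m)
  proper m d s k h := σ.proper (n + m) d s (n + k) (Nat.add_lt_add_left h n)
  toBody m := σ.toBody (n + m)
  toBody_naturality h := σ.toBody_naturality (Nat.add_le_add_left h n)
  isColimit := IsColimit.ofExistsUnique fun c =>
    σ.existsUnique_tailDesc n c.ι.app fun h => c.w (homOfLE h)
  base_toBody := Category.id_comp _

/-- The cells glued from the stage `n` on. -/
noncomputable def tailCellEquiv (n d : ℕ) :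
    (σ.tail n).Cell d ≃ {c : σ.Cell d // ¬ c.1 < n} :=
  Equiv.ofBijective (fun s => ⟨⟨n + s.1, s.2⟩, (n.le_add_right s.1).not_gt⟩) <| by
    constructor
    · rintro ⟨m, s⟩ ⟨m', s'⟩ e
      obtain rfl : m = m' := Nat.add_left_cancel (congrArg (fun c => c.1.1) e)
      cases e
      rfl
    · rintro ⟨⟨m, s⟩, h⟩
      obtain ⟨m, rfl⟩ := Nat.exists_eq_add_of_le (not_lt.mp h)
      exact ⟨⟨m, s⟩, rfl⟩

/-- The cells of a complex are those of its head and those of its tail. -/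
noncomputable def headTailEquiv (n d : ℕ) :
    (σ.head n).Cell d ⊕ (σ.tail n).Cell d ≃ σ.Cell d :=
  (Equiv.sumCongr ((σ.stageSystem n).cellEquiv d).symm (σ.tailCellEquiv n d)).trans
    (Equiv.sumCompl _)

lemma charMap_headTailEquiv_inl (n : ℕ) {d : ℕ} (s : (σ.head n).Cell d) :
    σ.charMap (σ.headTailEquiv n d (.inl s)) = (σ.head n).charMap s ≫ σ.toBody n := by
  obtain ⟨c, rfl⟩ := ((σ.stageSystem n).cellEquiv d).surjective s
  exact (σ.stageChar_toBody c).symm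

/-- A cell of the stratum `n` as a map from the complex with a single cell, which glues that cell
immediately, as the tail glues all cells of the stratum `n`. -/
noncomputable def cellToTail {n d : ℕ} (s : (σ.stratum n).cells d) :
    CellCx.Hom.{u} ⟨_, _, _, SingleCell.str d⟩ ⟨_, _, _, σ.tail n⟩ where
  left := (σ.stratum n).attach s
  right := σ.charMap ⟨n, s⟩
  stageMap
    | 0 => (σ.stratum n).attach s
    | m + 1 => (σ.stratum n).char s ≫ σ.stage.map (homOfLE (by omega : n + 1 ≤ n + (m + 1)))
  cellMap | _, _, .mk => s
  attach_stageMap := by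
    rintro _ _ ⟨⟩
    exact Category.id_comp _
  char_stageMap := by
    rintro _ _ ⟨⟩
    exact (Category.id_comp _).trans
      ((congrArg (_ ≫ ·) (σ.stage.map_id _)).trans (Category.comp_id _))
  stageMap_succ := by
    rintro (_ | m)
    · refine (congrArg (· ≫ _) (SingleCell.stage_succ d 0)).trans ?_
      refine (Category.assoc _ _ _).symm.trans ?_
      refine (congrArg (· ≫ _) ((σ.stratum n).attach_comp s).symm).trans ?_
      exact (Category.assoc _ _ _).trans (congrArg (_ ≫ ·) (σ.stage_map_comp _ _))
    · refine (congrArg (· ≫ _) (SingleCell.stage_succ d (m + 1))).trans ?_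
      refine (Category.id_comp _).trans ?_
      exact (congrArg (_ ≫ ·) (σ.stage_map_comp _ _).symm).trans (Category.assoc _ _ _).symm
  base_stageMap := (Category.id_comp _).trans (Category.comp_id _).symm
  toBody_right := by
    rintro (_ | m)
    · exact σ.boundary_charMap s
    · refine (Category.id_comp _).trans ?_
      exact (congrArg (_ ≫ ·) (σ.toBody_naturality _).symm).trans (Category.assoc _ _ _).symm

end CellStr

namespace CellCx

variable {W : AWFS TopCat.{u}} {κ : ∀ d, W.LeftStr (diskBoundaryInclusion.{u} d)}
  {F : CellCx.{u} ⥤ W.LMap}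

namespace PreservesComposition

lemma exists_str_eq_lift (hF : PreservesComposition F) {X Y Z : TopCat.{u}}
    {f : X ⟶ Y} {g : Y ⟶ Z} {k : X ⟶ Z} (hk : f ≫ g = k)
    {σ : CellStr f} {τ : CellStr g} {ρ : CellStr k} (e : ∀ d, σ.Cell d ⊕ τ.Cell d ≃ ρ.Cell d)
    (hσ : ∀ d (s : σ.Cell d), ρ.charMap (e d (.inl s)) = σ.charMap s ≫ g)
    (hτ : ∀ d (t : τ.Cell d), ρ.charMap (e d (.inr t)) = τ.charMap t)
    {α : W.LeftStr f} {β : W.LeftStr g} {γ : W.LeftStr k}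
    (hα : α.toLMap = F.obj ⟨_, _, _, σ⟩) (hβ : β.toLMap = F.obj ⟨_, _, _, τ⟩)
    (hγ : γ.toLMap = F.obj ⟨_, _, _, ρ⟩) :
    ∃ q : Arrow.mk g ⟶ W.R.obj (Arrow.mk k), γ.str = β.lift q := by
  subst hk
  have h := hF σ τ ρ ⟨e, hσ, hτ⟩
  rw [← hα, ← hβ, ← hγ] at h
  rw [h.eq_comp]
  exact ⟨α.push g, rfl⟩

/-- Split the complex at the stage from which a given cell is glued: the left structure of the whole
restricts along the tail, to which the cell is a map from a single-cell complex. -/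
lemma isCellular_str (hF : PreservesComposition F) (hU : F ⋙ W.forget = U)
    (hκ : ∀ d, (κ d).toLMap = F.obj (unit.obj ⟨d⟩)) (A : CellCx.{u}) {γ : W.LeftStr A.map}
    (hγ : γ.toLMap = F.obj A) : A.str.IsCellular κ γ.str := by
  rintro d ⟨n, s⟩
  obtain ⟨α, hα⟩ := AWFS.LMap.exists_toLMap_eq (F.obj ⟨_, _, _, A.str.head n⟩)
    (Functor.congr_obj hU ⟨_, _, _, A.str.head n⟩)
  obtain ⟨β, hβ⟩ := AWFS.LMap.exists_toLMap_eq (F.obj ⟨_, _, _, A.str.tail n⟩)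
    (Functor.congr_obj hU ⟨_, _, _, A.str.tail n⟩)
  obtain ⟨q, hq⟩ := hF.exists_str_eq_lift (A.str.toStage_toBody n) (A.str.headTailEquiv n)
    (fun _ => A.str.charMap_headTailEquiv_inl n) (fun _ _ => rfl) hα hβ hγ
  let c : unit.obj ⟨d⟩ ⟶ (⟨_, _, _, A.str.tail n⟩ : CellCx.{u}) := A.str.cellToTail s
  have str_tail : (κ d).str ≫ W.M.map (U.map c) = A.str.charMap ⟨n, s⟩ ≫ β.str :=
    AWFS.LeftStr.str_naturality (hκ d) hβ (F.map c) (U.map c) (Functor.hcongr_hom hU c)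
  have isLift_tail : (κ d).IsLift (A.str.charMap ⟨n, s⟩ ≫ β.str) := by
    rw [← str_tail]
    exact AWFS.LeftStr.isLift_str.map _
  rw [hq, AWFS.LeftStr.lift, ← Category.assoc, ← Category.assoc]
  exact (isLift_tail.map q).mul

lemma eq_toLMap (hF : PreservesComposition F) (hU : F ⋙ W.forget = U)
    (hκ : ∀ d, (κ d).toLMap = F.obj (unit.obj ⟨d⟩)) : F = toLMap κ := by
  have hobj (A : CellCx.{u}) : F.obj A = (toLMap κ).obj A := by
    obtain ⟨γ, hγ⟩ := AWFS.LMap.exists_toLMap_eq (F.obj A) (Functor.congr_obj hU A)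
    rw [← hγ, ← CellStr.leftStr_eq (hF.isCellular_str hU hκ A hγ)]
    rfl
  exact Functor.hext hobj fun A B φ =>
    AWFS.LMap.hom_heq (hobj A) (hobj B) (Functor.hcongr_hom hU φ)

end PreservesComposition

end CellCx

theorem proposition4p13 :
    (∀ {X Y Z : TopCat.{u}} {f : X ⟶ Y} {g : Y ⟶ Z} (σ : CellStr f) (τ : CellStr g),
      ∃ ρ : CellStr (f ≫ g), σ.IsComposite τ ρ) ∧
    ∀ (W : AWFS TopCat.{u}) (F : Discrete ℕ ⥤ W.LMap), F ⋙ W.forget = genCells →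
      ∃! F' : CellCx.{u} ⥤ W.LMap,
        F' ⋙ W.forget = CellCx.U ∧ F = CellCx.unit ⋙ F' ∧ CellCx.PreservesComposition F' := by
  refine ⟨fun σ τ => σ.exists_isComposite τ, fun W F hF => ?_⟩
  choose κ hκ using fun d : ℕ =>
    AWFS.LMap.exists_toLMap_eq (F.obj ⟨d⟩) (Functor.congr_obj hF ⟨d⟩)
  refine ⟨CellCx.toLMap κ, ⟨rfl, ?_, CellCx.toLMap_preservesComposition κ⟩, ?_⟩
  · refine Discrete.functor_ext fun d => ?_
    rw [← hκ, ← CellCx.leftStr_singleCell κ d]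
    rfl
  · rintro F' ⟨hU, rfl, hF'⟩
    exact CellCx.PreservesComposition.eq_toLMap hF' hU hκ
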